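/- Let $p>2$ be a prime, let $\mathbb{F}_q$ be a finite field of characteristic $p$ and let $K=\overline{\mathbb{F}}_q$. Let $\mathcal X\subset\mathbb{P}^2(K)$ be a geometrically irreducible plane curve defined over $\mathbb{F}_q$, not a line, with homogeneous equation $F=0$ and function field $K(\mathcal X)$. Let $\gamma=(F_X:F_Y:F_Z)$ be its Gauss map, which sends a nonsingular point to its tangent line, and write $\gamma=\Phi_{p^r}\circ\gamma_s$, where $\gamma_s=(z_0:z_1:z_2)$ is a separable rational map, $p^r$ ($r\ge 0$) is the inseparable degree of $\gamma$, and $\Phi_{p^r}$ is the $p^r$-Frobenius map; thus $\gamma=(z_0^{p^r}:z_1^{p^r}:z_2^{p^r})$. Let $\operatorname{Aut}(\mathcal X)$ be the group of $K$-automorphisms of $K(\mathcal X)$ and let $G\le\operatorname{Aut}(\mathcal X)$ be a nontrivial subgroup all of whose elements are induced by projective transformations of $\mathbb{P}^2(K)$. Suppose that $\gamma_s(\mathcal X)$ is a subcover of $\mathcal X/G$, i.e. $K(\gamma_s(\mathcal X))\subseteq K(\mathcal X)^G$. Then $r>0$, $G$ is finite, and, after a projective transformation over $K$, there are homogeneous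 polynomials $Z_1,Z_2\in K[X,Y,Z]$ of the same degree, with images $z_1,z_2$ in the fraction field of the homogeneous coordinate ring of $\mathcal X$, such that $\gamma_s=(0:z_1:z_2)$, the polynomial defining $\mathcal X$ divides $$Z_1^{p^r}\,Y+Z_2^{p^r}\,Z,$$ and the following hold. (i) For every $\sigma\in G$ there are $a,b,c\in K$ with $a\neq 0$ such that $\sigma:(X:Y:Z)\mapsto(aX+bY+cZ:Y:Z)$. (ii) $G=E_p\rtimes C$, where $E_p$ is an elementary abelian $p$-group (possibly trivial) and $C$ is a cyclic group of order prime to $p$ such that $|C|$ divides $|E_p|-1$. Moreover, in (i) one has $a^{|E_p|-1}=1$, and for $\sigma\neq 1$ one has $a=1$ if and only if $\sigma$ has order $p$. -/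

import Mathlib

/-- An irreducible plane projective curve over a field `K`, given by an irreducible homogeneous
polynomial in the three variables `X = X 0`, `Y = X 1`, `Z = X 2`. Over an algebraically closed
field these are exactly the (geometrically) irreducible curves of the projective plane. -/
structure PlaneCurve (K : Type*) [Field K] where
  poly : MvPolynomial (Fin 3) K
  degree : ℕ
  isHomogeneous : poly.IsHomogeneous degree
  irreducible : Irreducible poly

namespace PlaneCurve

variable {K : Type*} [Field K]

/-- The curve is defined over the subfield `k` of `K`: it has an equation with coefficients
in `k`. -/
def IsDefinedOver (k : Type*) [Field k] [Algebra k K] (C : PlaneCurve K) : Prop :=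
  ∃ F : MvPolynomial (Fin 3) k, MvPolynomial.map (algebraMap k K) F = C.poly

/-- The homogeneous coordinate ring. -/
abbrev CoordRing (C : PlaneCurve K) : Type _ :=
  MvPolynomial (Fin 3) K ⧸ Ideal.span {C.poly}

instance instIsDomainCoordRing (C : PlaneCurve K) : IsDomain C.CoordRing :=
  (Ideal.Quotient.isDomain_iff_prime _).2
    ((Ideal.span_singleton_prime C.irreducible.ne_zero).2 C.irreducible.prime)

/-- The fraction field of the homogeneous coordinate ring (the function field of the affine
cone). A rational map from the curve to the projective plane is a nonzero triple of elements of
this field, up to a common factor, whose quotients lie in the function field of the curve. -/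
abbrev ConeField (C : PlaneCurve K) : Type _ := FractionRing C.CoordRing

/-- The projection of a polynomial to the homogeneous coordinate ring, as an element of its
fraction field. -/
noncomputable def proj (C : PlaneCurve K) : MvPolynomial (Fin 3) K →ₐ[K] C.ConeField :=
  (IsScalarTower.toAlgHom K C.CoordRing C.ConeField).comp
    (Ideal.Quotient.mkₐ K (Ideal.span {C.poly}))

/-- The projective coordinates `(x : y : z)` of the generic point of the curve. -/
noncomputable def coord (C : PlaneCurve K) (i : Fin 3) : C.ConeField :=
  C.proj (MvPolynomial.X i)

/-- The field `K(z_i / z_j : i, j)`: the function field of the closure of the image of the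
rational map `(z 0 : z 1 : z 2)`. -/
noncomputable def imageField (C : PlaneCurve K) (z : Fin 3 → C.ConeField) :
    IntermediateField K C.ConeField :=
  IntermediateField.adjoin K {f | ∃ i j : Fin 3, f = z i / z j}

/-- The function field `K(C)` of the curve. -/
noncomputable def functionField (C : PlaneCurve K) : IntermediateField K C.ConeField :=
  C.imageField C.coord

/-- The coordinate function `x_i / x_j` as an element of the function field. -/
noncomputable def coordQuot (C : PlaneCurve K) (i j : Fin 3) : C.functionField :=
  ⟨C.coord i / C.coord j, IntermediateField.subset_adjoin K _ ⟨i, j, rfl⟩⟩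

/-- The Gauss map `γ = (F_X : F_Y : F_Z)`, which sends a nonsingular point to its tangent line,
the osculating hyperplane of a plane curve. -/
noncomputable def gaussMap (C : PlaneCurve K) (i : Fin 3) : C.ConeField :=
  C.proj (MvPolynomial.pderiv i C.poly)

/-- `(z 0 : z 1 : z 2)` is the separable part `γ_s` of the Gauss map, and `p ^ r` is the
inseparable degree of the Gauss map: `γ = (z 0 ^ p ^ r : z 1 ^ p ^ r : z 2 ^ p ^ r)`, that is,
`γ` is `γ_s` followed by the `p ^ r`-Frobenius map, and `γ_s` is a separable rational map on the
curve. For a line there is no such `γ_s`, since its function field is not algebraic over the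
constants. -/
def IsSeparableGaussMap (C : PlaneCurve K) (p r : ℕ) (z : Fin 3 → C.ConeField) : Prop :=
  z ≠ 0 ∧
  C.imageField z ≤ C.functionField ∧
  (∀ i j, C.gaussMap i * z j ^ p ^ r = C.gaussMap j * z i ^ p ^ r) ∧
  ∀ f ∈ C.functionField, IsSeparable (C.imageField z) f

/-- The automorphism group of the curve: the `K`-automorphisms of its function field. -/
abbrev Aut (C : PlaneCurve K) : Type _ := C.functionField ≃ₐ[K] C.functionField

/-- The linear form `∑ j, M i j * X j`, the `i`-th coordinate of `M (X, Y, Z)`. -/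
noncomputable def linForm (M : Matrix (Fin 3) (Fin 3) K) (i : Fin 3) :
    MvPolynomial (Fin 3) K :=
  ∑ j, MvPolynomial.C (M i j) * MvPolynomial.X j

/-- The automorphism `σ` is the restriction to the curve of the projective map `P ↦ M P`, acting
on functions by `f ↦ f ∘ M`. -/
def IsInducedBy (C : PlaneCurve K) (σ : C.Aut) (M : Matrix (Fin 3) (Fin 3) K) : Prop :=
  ∀ i j, (σ (C.coordQuot i j) : C.ConeField) = C.proj (linForm M i) / C.proj (linForm M j)

/-- All elements of `G` are induced by projective transformations of the plane. -/
def IsLinear (C : PlaneCurve K) (G : Subgroup C.Aut) : Prop :=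
  ∀ σ ∈ G, ∃ M : GL (Fin 3) K, C.IsInducedBy σ (M : Matrix (Fin 3) (Fin 3) K)

/-- The function field `K(C)^G` of the quotient curve `C / G`. -/
noncomputable def quotientField (C : PlaneCurve K) (G : Subgroup C.Aut) :
    IntermediateField K C.ConeField :=
  IntermediateField.lift (IntermediateField.fixedField G)

/-- `C'` has the equation `F (T (X, Y, Z)) = 0`, where `F = 0` is the equation of `C`; so
`P ↦ T P` maps `C'` onto `C`. -/
def IsTransformOf (C' C : PlaneCurve K) (T : GL (Fin 3) K) : Prop :=
  C'.poly = MvPolynomial.aeval (linForm (T : Matrix (Fin 3) (Fin 3) K)) C.poly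

end PlaneCurve

/-! Let `σ ∈ G` be nontrivial, induced by a matrix `M`, and let `F` be the equation of the curve.
The ratios of the components of `γ` are `p ^ r`-th powers of elements of `K(γ_s)`, so `σ` fixes them
and `γ ∘ M` is proportional to `γ`. Differentiating `F ∘ M = F * H` along the curve then shows that
`γ` is an eigenvector of the transpose of `M` (`IsInducedBy.exists_transpose_mulVec_gaussMap`). The
eigenvalue is a root of a polynomial over `K`, hence a constant `c`. As `σ ≠ 1`, the matrix `M - c`
has a nonzero column, and this column is a point common to all tangent lines: the curve is strange.

Move that point to `(1 : 0 : 0)`, so that `F_X = 0`. The other two components of `γ` are linearly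
independent over `K`, since `γ` is not constant. The eigenvector equation therefore forces every
matrix of `G`, up to a scalar, into the shape of (i) (`IsInducedBy.exists_conj`). Euler's relation
`Y F_Y + Z F_Z = 0` yields the divisibility (`IsSeparableGaussMap.exists_forms`). If `r = 0`, the
same relation gives `γ_s = (0 : -Z : Y)`; the derivation `∂/∂X` of the coordinate ring kills
`K(γ_s)` but not `X / Y`, against separability (`IsSeparableGaussMap.pos_of_gaussMap_eq_zero`).

The group `G` is finite because the coordinate functions are integral over a field fixed by `G`
(`IsSeparableGaussMap.finite`). Its structure comes from the character `σ ↦ a`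
(`exists_semidirect_of_affine`): the kernel consists of translations and has exponent `p`, its index
is prime to `p` because `Kˣ` has no `p`-torsion, and Schur–Zassenhaus gives a complement. The
complement embeds in `Kˣ`, so it is cyclic, and it acts freely on the nontrivial translations. -/

namespace PlaneCurve

open MvPolynomial

variable {K : Type*} [Field K]

/-! ### Linear substitutions, homogeneous polynomials and the cone field. -/

theorem linForm_isHomogeneous (M : Matrix (Fin 3) (Fin 3) K) (i : Fin 3) :
    (linForm M i).IsHomogeneous 1 := by
  refine IsHomogeneous.sum _ _ _ fun j _ => ?_
  simpa using (isHomogeneous_C (Fin 3) (M i j)).mul (isHomogeneous_X K j)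

theorem linForm_one (i : Fin 3) : linForm (1 : Matrix (Fin 3) (Fin 3) K) i = X i := by
  simp [linForm, Matrix.one_apply]

theorem pderiv_linForm (M : Matrix (Fin 3) (Fin 3) K) (i j : Fin 3) :
    pderiv j (linForm M i) = C (M i j) := by
  classical
  simp [linForm, pderiv_X, Pi.single_apply]

theorem aeval_linForm {A : Type*} [CommRing A] [Algebra K A] (v : Fin 3 → A)
    (M : Matrix (Fin 3) (Fin 3) K) (i : Fin 3) :
    aeval v (linForm M i) = ∑ j, algebraMap K A (M i j) * v j := by
  simp [linForm]

theorem aeval_linForm_linForm (M N : Matrix (Fin 3) (Fin 3) K) (i : Fin 3) :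
    aeval (linForm M) (linForm N i) = linForm (N * M) i := by
  rw [aeval_linForm]
  simp only [linForm, Matrix.mul_apply, Finset.mul_sum, map_sum, algebraMap_eq, Finset.sum_mul,
    C_mul]
  rw [Finset.sum_comm]
  simp only [mul_assoc]

/-- The linear change of variables `P ↦ P (T (X, Y, Z))`. -/
noncomputable def linEquiv (T : GL (Fin 3) K) :
    MvPolynomial (Fin 3) K ≃ₐ[K] MvPolynomial (Fin 3) K :=
  AlgEquiv.ofAlgHom (aeval (linForm (T : Matrix (Fin 3) (Fin 3) K)))
    (aeval (linForm ((T⁻¹ : GL (Fin 3) K) : Matrix (Fin 3) (Fin 3) K)))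
    (by
      ext i : 1
      rw [AlgHom.comp_apply, aeval_X, aeval_linForm_linForm, ← Units.val_mul, inv_mul_cancel,
        Units.val_one, linForm_one, AlgHom.id_apply])
    (by
      ext i : 1
      rw [AlgHom.comp_apply, aeval_X, aeval_linForm_linForm, ← Units.val_mul, mul_inv_cancel,
        Units.val_one, linForm_one, AlgHom.id_apply])

theorem linEquiv_apply (T : GL (Fin 3) K) (P : MvPolynomial (Fin 3) K) :
    linEquiv T P = aeval (linForm (T : Matrix (Fin 3) (Fin 3) K)) P := rfl

theorem IsHomogeneous.aeval_linForm {P : MvPolynomial (Fin 3) K} {n : ℕ}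
    (hP : P.IsHomogeneous n) (M : Matrix (Fin 3) (Fin 3) K) :
    (aeval (linForm M) P).IsHomogeneous n := by
  simpa using hP.aeval (linForm M) (fun i => linForm_isHomogeneous M i)

/-- The chain rule. -/
theorem pderiv_aeval (l : Fin 3 → MvPolynomial (Fin 3) K) (j : Fin 3)
    (P : MvPolynomial (Fin 3) K) :
    pderiv j (aeval l P) = ∑ i, aeval l (pderiv i P) * pderiv j (l i) := by
  classical
  induction P using MvPolynomial.induction_on with
  | C a => simp
  | add P Q hP hQ => simp only [map_add, hP, hQ, add_mul, Finset.sum_add_distrib]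
  | mul_X P n hP =>
    simp only [map_mul, aeval_X, Derivation.leibniz, hP, smul_eq_mul, map_add, pderiv_X,
      Pi.single_apply, Finset.mul_sum, add_mul, Finset.sum_add_distrib]
    congr 1
    · simp
    · exact Finset.sum_congr rfl fun i _ => by ring

theorem aeval_smul_of_isHomogeneous {A : Type*} [CommRing A] [Algebra K A]
    {P : MvPolynomial (Fin 3) K} {n : ℕ} (hP : P.IsHomogeneous n) (s : A) (v : Fin 3 → A) :
    aeval (fun i => s * v i) P = s ^ n * aeval v P := by
  simp only [aeval_def, eval₂_eq, Finset.mul_sum]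
  refine Finset.sum_congr rfl fun m hm => ?_
  have hdeg : ∑ i, m i = n := by
    have h := hP (mem_support_iff.1 hm)
    rw [Finsupp.weight_apply, Finsupp.sum_fintype _ _ (by simp)] at h
    simpa using h
  have hs : ∏ i ∈ m.support, s ^ m i = s ^ n := by
    rw [Finset.prod_pow_eq_pow_sum, ← hdeg,
      Finset.sum_subset (Finset.subset_univ _) (fun i _ hi => Finsupp.notMem_support_iff.1 hi)]
  simp only [mul_pow, Finset.prod_mul_distrib, hs]
  ring

theorem aeval_div_of_isHomogeneous {A : Type*} [Field A] [Algebra K A]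
    {P : MvPolynomial (Fin 3) K} {n : ℕ} (hP : P.IsHomogeneous n) (s : A) (v : Fin 3 → A) :
    aeval (fun i => v i / s) P = aeval v P / s ^ n := by
  have h := aeval_smul_of_isHomogeneous hP s⁻¹ v
  simp only [div_eq_inv_mul, h, inv_pow]

/-- Over a perfect field, a polynomial whose partial derivatives vanish is a `p`-th power. -/
theorem exists_pow_eq_of_pderiv_eq_zero (p : ℕ) [Fact p.Prime] [CharP K p] [PerfectRing K p]
    (F : MvPolynomial (Fin 3) K) (h : ∀ i, pderiv i F = 0) : ∃ G, G ^ p = F := by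
  have hdvd : ∀ m ∈ F.support, ∀ i, p ∣ m i := by
    intro m hm i
    by_contra hp
    have h0 : m i ≠ 0 := fun h0 => hp (h0 ▸ dvd_zero p)
    -- The coefficient of `∂F/∂X_i` at `m - e_i` is `m i` times that of `F` at `m`.
    have hc := coeff_pderiv (i := i) F (m - Finsupp.single i 1)
    rw [h i, coeff_zero, tsub_add_cancel_of_le (by
      rw [Finsupp.single_le_iff]; omega)] at hc
    have hcast : ((m i : ℕ) : K) ≠ 0 := fun hc => hp ((CharP.cast_eq_zero_iff K p _).1 hc)
    have h1 : (((m - Finsupp.single i 1 : Fin 3 →₀ ℕ) i : ℕ) : K) + 1 = m i := by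
      rw [Finsupp.tsub_apply, Finsupp.single_eq_same, ← Nat.cast_add_one]
      congr 1
      omega
    rw [h1] at hc
    exact (mul_ne_zero (mem_support_iff.1 hm) hcast) hc.symm
  have : CharP (MvPolynomial (Fin 3) K) p := inferInstance
  refine ⟨∑ m ∈ F.support, monomial (m.mapRange (· / p) (by simp))
    ((frobeniusEquiv K p).symm (coeff m F)), ?_⟩
  rw [sum_pow_char]
  conv_rhs => rw [F.as_sum]
  refine Finset.sum_congr rfl fun m hm => ?_
  rw [monomial_pow, frobeniusEquiv_symm_pow_p]
  have hm' : p • m.mapRange (· / p) (by simp) = m :=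
    Finsupp.ext fun i => by simpa using Nat.mul_div_cancel' (hdvd m hm i)
  rw [hm']

variable (C : PlaneCurve K)

theorem proj_eq_zero_iff (P : MvPolynomial (Fin 3) K) : C.proj P = 0 ↔ C.poly ∣ P := by
  rw [← Ideal.mem_span_singleton, ← Ideal.Quotient.eq_zero_iff_mem,
    ← map_eq_zero_iff (algebraMap C.CoordRing C.ConeField)
      (IsFractionRing.injective C.CoordRing C.ConeField)]
  rfl

theorem proj_poly : C.proj C.poly = 0 := (C.proj_eq_zero_iff _).2 dvd_rfl

theorem aeval_coord (P : MvPolynomial (Fin 3) K) : aeval C.coord P = C.proj P := by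
  have : aeval C.coord = C.proj := by ext i; simp [coord]
  rw [this]

theorem proj_aeval (l : Fin 3 → MvPolynomial (Fin 3) K) (P : MvPolynomial (Fin 3) K) :
    C.proj (aeval l P) = aeval (fun i => C.proj (l i)) P := by
  rw [← AlgHom.comp_apply, comp_aeval]

theorem proj_linForm (M : Matrix (Fin 3) (Fin 3) K) (i : Fin 3) :
    C.proj (linForm M i) = ∑ j, algebraMap K _ (M i j) * C.coord j := by
  rw [← aeval_coord, aeval_linForm]

theorem totalDegree_poly : C.poly.totalDegree = C.degree :=
  C.isHomogeneous.totalDegree C.irreducible.ne_zero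

theorem degree_pos : 0 < C.degree := by
  rw [← totalDegree_poly, Nat.pos_iff_ne_zero]
  intro h
  apply C.irreducible.not_isUnit
  have hC := totalDegree_eq_zero_iff_eq_C.1 h
  rw [hC]
  refine IsUnit.map MvPolynomial.C (Ne.isUnit fun h0 => C.irreducible.ne_zero ?_)
  rw [hC, h0, C_0]

theorem eq_zero_of_proj_eq_zero {P : MvPolynomial (Fin 3) K} {n : ℕ} (hP : P.IsHomogeneous n)
    (hn : n < C.degree) (h : C.proj P = 0) : P = 0 := by
  by_contra h0
  have hle := totalDegree_le_of_dvd_of_isDomain ((C.proj_eq_zero_iff P).1 h) h0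
  rw [totalDegree_poly, hP.totalDegree h0] at hle
  omega

end PlaneCurve

/-! ### Nonconstancy of the generic point, of `γ_s` and of `γ`. -/

namespace PlaneCurve

open MvPolynomial

variable {K : Type*} [Field K]

theorem mem_range_of_isAlgebraic [IsAlgClosed K] {A : Type*} [Field A] [Algebra K A] {a : A}
    (ha : IsAlgebraic K a) : ∃ c : K, algebraMap K A c = a :=
  minpoly.mem_range_of_degree_eq_one K a
    (IsAlgClosed.degree_eq_one_of_irreducible K (minpoly.irreducible ha.isIntegral))

theorem mem_range_of_pow [IsAlgClosed K] {A : Type*} [Field A] [Algebra K A] {a : A} {n : ℕ}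
    (hn : 0 < n) (c : K) (ha : algebraMap K A c = a ^ n) : ∃ c : K, algebraMap K A c = a :=
  mem_range_of_isAlgebraic (IsAlgebraic.of_pow hn (ha ▸ isAlgebraic_algebraMap c))

variable (C : PlaneCurve K)

/-- The linear form with coefficients `v`. -/
noncomputable abbrev rowForm (v : Fin 3 → K) : MvPolynomial (Fin 3) K :=
  linForm (Matrix.of fun _ => v) 0

/-- If the generic point were constant, every linear form vanishing at `c` would be divisible by the
equation. Nonzero ones would then be scalar multiples of it, but there are two independent ones.
Lines are not excluded, so the result can be used to prove that the degree is at least 2. -/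
theorem coord_ne_mul_const (w : C.ConeField) (c : Fin 3 → K) :
    ∃ i, C.coord i ≠ algebraMap K _ (c i) * w := by
  by_contra! h
  have key : ∀ v : Fin 3 → K, ∑ i, v i * c i = 0 → C.poly ∣ rowForm v := by
    intro v hv
    rw [← proj_eq_zero_iff, proj_linForm]
    simp only [Matrix.of_apply, h, ← mul_assoc, ← map_mul]
    rw [← Finset.sum_mul, ← map_sum, hv, map_zero, zero_mul]
  -- a nonzero linear form in the ideal is a scalar multiple of the equation of the curve
  have key2 : ∀ v : Fin 3 → K, v ≠ 0 → ∑ i, v i * c i = 0 →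
      ∃ a : K, a ≠ 0 ∧ rowForm v = C.poly * MvPolynomial.C a := by
    intro v hv0 hv
    have hne : rowForm v ≠ 0 := by
      intro h0
      apply hv0
      ext j
      have := pderiv_linForm (Matrix.of fun _ => v) 0 j
      rw [show linForm (Matrix.of fun _ => v) 0 = 0 from h0, map_zero] at this
      simpa using this.symm
    obtain ⟨H, hH⟩ := key v hv
    have hH0 : H ≠ 0 := by rintro rfl; simp [hne] at hH
    have hdeg : (rowForm v).totalDegree = 1 := (linForm_isHomogeneous _ 0).totalDegree hne
    rw [hH, totalDegree_mul_of_isDomain C.irreducible.ne_zero hH0, totalDegree_poly] at hdeg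
    have hpos := C.degree_pos
    have hd : H.totalDegree = 0 := by omega
    rw [totalDegree_eq_zero_iff_eq_C.1 hd] at hH hH0
    exact ⟨_, fun h0 => hH0 (by rw [h0, C_0]), hH⟩
  have key3 : ∀ v v' : Fin 3 → K, v ≠ 0 → v' ≠ 0 → ∑ i, v i * c i = 0 → ∑ i, v' i * c i = 0 →
      ∃ a : K, ∀ i, v i = a * v' i := by
    intro v v' hv hv' hvc hvc'
    obtain ⟨a, -, ha⟩ := key2 v hv hvc
    obtain ⟨a', ha0', ha'⟩ := key2 v' hv' hvc'
    refine ⟨a / a', fun i => ?_⟩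
    have h1 := pderiv_linForm (Matrix.of fun _ => v) 0 i
    have h2 := pderiv_linForm (Matrix.of fun _ => v') 0 i
    rw [show linForm (Matrix.of fun _ => v) 0 = _ from ha, mul_comm, pderiv_C_mul] at h1
    rw [show linForm (Matrix.of fun _ => v') 0 = _ from ha', mul_comm, pderiv_C_mul] at h2
    apply C_injective (Fin 3) K
    rw [C_mul, show MvPolynomial.C (v i) = _ from h1.symm,
      show MvPolynomial.C (v' i) = _ from h2.symm, ← mul_assoc, ← C_mul,
      div_mul_cancel₀ _ ha0']
  -- Each case exhibits two non-proportional vectors orthogonal to `c`.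
  by_cases h0 : c 0 = 0
  · by_cases h1 : c 1 = 0
    · obtain ⟨a, ha⟩ := key3 ![1, 0, 0] ![0, 1, 0] (fun h => one_ne_zero (congrFun h 0))
        (fun h => one_ne_zero (congrFun h 1)) (by simp [Fin.sum_univ_three, h0])
        (by simp [Fin.sum_univ_three, h1])
      simpa using ha 0
    · obtain ⟨a, ha⟩ := key3 ![1, 0, 0] ![0, - c 2, c 1] (fun h => one_ne_zero (congrFun h 0))
        (fun h => h1 (by simpa using congrFun h 2)) (by simp [Fin.sum_univ_three, h0])
        (by simp [Fin.sum_univ_three]; ring)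
      simpa using ha 0
  · obtain ⟨a, ha⟩ := key3 ![- c 1, c 0, 0] ![- c 2, 0, c 0]
      (fun h => h0 (by simpa using congrFun h 1)) (fun h => h0 (by simpa using congrFun h 2))
      (by simp [Fin.sum_univ_three]; ring) (by simp [Fin.sum_univ_three]; ring)
    exact h0 (by simpa using ha 1)

variable {C}

theorem linearIndependent_coord (hd : 2 ≤ C.degree) {v : Fin 3 → K}
    (h : ∑ i, algebraMap K C.ConeField (v i) * C.coord i = 0) : v = 0 := by
  have h0 := C.eq_zero_of_proj_eq_zero (linForm_isHomogeneous (Matrix.of fun _ => v) 0)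
    (by omega) (by rw [proj_linForm]; exact h)
  ext j
  have := pderiv_linForm (Matrix.of fun _ => v) 0 j
  rw [h0, map_zero] at this
  simpa using this.symm

theorem proj_linForm_ne_zero (hd : 2 ≤ C.degree) (M : GL (Fin 3) K) (i : Fin 3) :
    C.proj (linForm (M : Matrix (Fin 3) (Fin 3) K) i) ≠ 0 := by
  rw [proj_linForm]
  intro h
  have h1 : (M : Matrix (Fin 3) (Fin 3) K) i = 0 := linearIndependent_coord hd h
  have h2 : ((M : Matrix (Fin 3) (Fin 3) K) *
      ((M⁻¹ : GL (Fin 3) K) : Matrix (Fin 3) (Fin 3) K)) i i = 1 := by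
    rw [← Units.val_mul, mul_inv_cancel]; simp
  rw [Matrix.mul_apply] at h2
  simp [h1] at h2

theorem coord_ne_zero (hd : 2 ≤ C.degree) (i : Fin 3) : C.coord i ≠ 0 := by
  have := proj_linForm_ne_zero hd (1 : GL (Fin 3) K) i
  rwa [Units.val_one, linForm_one] at this

/-- The partial derivatives have degree less than the curve, so if they vanish on it they vanish
identically; the equation would then be a `p`-th power. -/
theorem gaussMap_ne_zero (p : ℕ) [Fact p.Prime] [CharP K p] [PerfectRing K p] :
    ∃ i, C.gaussMap i ≠ 0 := by
  by_contra! h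
  obtain ⟨G, hG⟩ := exists_pow_eq_of_pderiv_eq_zero p C.poly fun i =>
    C.eq_zero_of_proj_eq_zero C.isHomogeneous.pderiv
      (Nat.sub_lt C.degree_pos one_pos) (h i)
  exact not_irreducible_pow (Fact.out : p.Prime).ne_one (hG ▸ C.irreducible)

theorem sum_coord_mul_gaussMap : ∑ i, C.coord i * C.gaussMap i = 0 := by
  have h := congrArg C.proj C.isHomogeneous.sum_X_mul_pderiv
  rw [nsmul_eq_mul, map_mul, proj_poly, mul_zero, map_sum] at h
  rw [← h]
  exact Finset.sum_congr rfl fun i _ => (map_mul C.proj _ _).symm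

variable {p r : ℕ} {z : Fin 3 → C.ConeField}

/-- A constant `γ_s` has image field `K`. By separability the coordinate functions would be
algebraic over `K`, hence constant. -/
theorem IsSeparableGaussMap.ne_mul_const [IsAlgClosed K]
    (hz : C.IsSeparableGaussMap p r z) (w : C.ConeField) (c : Fin 3 → K) :
    ∃ i, z i ≠ algebraMap K _ (c i) * w := by
  classical
  by_contra! h
  have hbot : C.imageField z = ⊥ := by
    rw [eq_bot_iff, imageField, IntermediateField.adjoin_le_iff]
    rintro _ ⟨i, j, rfl⟩
    -- For `w = 0` the quotient is `0 / 0 = 0`, whatever `c i / c j` is.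
    refine IntermediateField.mem_bot.2 ⟨if w = 0 then 0 else c i / c j, ?_⟩
    rw [h i, h j]
    split_ifs with hw
    · simp [hw]
    · rw [map_div₀, mul_div_mul_right _ _ hw]
  have hmem : ∀ i j, ∃ a : K, algebraMap K C.ConeField a = C.coord i / C.coord j := by
    intro i j
    have hs := (hz.2.2.2 _ (C.coordQuot i j).2).isIntegral.isAlgebraic
    rw [hbot] at hs
    exact mem_range_of_isAlgebraic (hs.restrictScalars K)
  by_cases hx : ∃ j, C.coord j ≠ 0
  · obtain ⟨j, hj⟩ := hx
    choose a ha using fun i => hmem i j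
    obtain ⟨i, hi⟩ := C.coord_ne_mul_const (C.coord j) a
    exact hi (by rw [ha, div_mul_cancel₀ _ hj])
  · push Not at hx
    obtain ⟨i, hi⟩ := C.coord_ne_mul_const 0 0
    exact hi (by simp [hx])

theorem IsSeparableGaussMap.exists_gaussMap_eq [Fact p.Prime] [CharP K p] [PerfectRing K p]
    (hz : C.IsSeparableGaussMap p r z) :
    ∃ μ, μ ≠ 0 ∧ ∀ i, C.gaussMap i = μ * z i ^ p ^ r := by
  obtain ⟨i, hi⟩ := gaussMap_ne_zero (C := C) p
  obtain ⟨j, hj⟩ := Function.ne_iff.1 hz.1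
  have hj : z j ≠ 0 := hj
  have hpow : z j ^ p ^ r ≠ 0 := pow_ne_zero _ hj
  have h := hz.2.2.1 i j
  have hgj : C.gaussMap j ≠ 0 := by
    intro h0
    rw [h0, zero_mul] at h
    exact mul_ne_zero hi hpow h
  refine ⟨C.gaussMap j / z j ^ p ^ r, div_ne_zero hgj hpow, fun l => ?_⟩
  rw [div_mul_eq_mul_div, ← hz.2.2.1 l j, mul_div_cancel_right₀ _ hpow]

/-- If `γ` is constant, the `z i / z j` have constant `p ^ r`-th powers, so they are constant too
because `K` is algebraically closed. -/
theorem IsSeparableGaussMap.gaussMap_ne_mul_const [IsAlgClosed K] [Fact p.Prime] [CharP K p]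
    (hz : C.IsSeparableGaussMap p r z) (w : C.ConeField) (c : Fin 3 → K) :
    ∃ i, C.gaussMap i ≠ algebraMap K _ (c i) * w := by
  by_contra! h
  obtain ⟨μ, hμ, hg⟩ := hz.exists_gaussMap_eq
  obtain ⟨j, hj⟩ := Function.ne_iff.1 hz.1
  have hj : z j ≠ 0 := hj
  have hpos : 0 < p ^ r := pow_pos (Fact.out : p.Prime).pos r
  have hmem : ∀ i, ∃ a : K, algebraMap K C.ConeField a = z i / z j := by
    intro i
    refine mem_range_of_pow hpos (c i / c j) ?_
    have hw : algebraMap K _ (c j) * w ≠ 0 := by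
      rw [← h, hg]; exact mul_ne_zero hμ (pow_ne_zero _ hj)
    rw [div_pow, ← mul_div_mul_left _ _ hμ, ← hg, ← hg, h, h, map_div₀,
      mul_div_mul_right _ _ (right_ne_zero_of_mul hw)]
  choose a ha using hmem
  obtain ⟨i, hi⟩ := hz.ne_mul_const (z j) a
  exact hi (by rw [ha, div_mul_cancel₀ _ hj])

/-- The Gauss map of a line is constant. -/
theorem IsSeparableGaussMap.two_le_degree [IsAlgClosed K] [Fact p.Prime] [CharP K p]
    (hz : C.IsSeparableGaussMap p r z) : 2 ≤ C.degree := by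
  by_contra! hd
  have h0 : ∀ i, (pderiv i C.poly).totalDegree = 0 := fun i => by
    have := (C.isHomogeneous.pderiv (i := i)).totalDegree_le
    omega
  obtain ⟨i, hi⟩ := hz.gaussMap_ne_mul_const 1 fun i => coeff 0 (pderiv i C.poly)
  apply hi
  rw [gaussMap, totalDegree_eq_zero_iff_eq_C.1 (h0 i), mul_one, coeff_C, if_pos rfl]
  exact C.proj.commutes _

end PlaneCurve

/-! ### The Gauss map as an eigenvector. -/

namespace PlaneCurve

open MvPolynomial Matrix

variable {K : Type*} [Field K] {C : PlaneCurve K}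

/-- The value of an automorphism on a quotient of forms of the same degree. -/
theorem IsInducedBy.coe_apply_eq {σ : C.Aut} {M : Matrix (Fin 3) (Fin 3) K}
    (hσ : C.IsInducedBy σ M)
    {P : MvPolynomial (Fin 3) K} {n : ℕ} (hP : P.IsHomogeneous n) (f : C.functionField)
    (hf : (f : C.ConeField) = C.proj P / C.coord 2 ^ n) :
    (σ f : C.ConeField) =
      C.proj (aeval (linForm M) P) /
        C.proj (linForm M 2) ^ n := by
  have h1 : f = aeval (fun i => C.coordQuot i 2) P := by
    apply Subtype.ext
    rw [hf, ← aeval_coord, ← aeval_div_of_isHomogeneous hP]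
    exact (aeval_algebraMap_apply C.ConeField (fun i => C.coordQuot i 2) P)
  rw [h1]
  have h2 : σ (aeval (fun i => C.coordQuot i 2) P) = aeval (fun i => σ (C.coordQuot i 2)) P := by
    have := map_aeval (fun i => C.coordQuot i 2) (σ : C.functionField →+* C.functionField) P
    rw [aeval_def, aeval_def]
    rw [aeval_def] at this
    exact (eval₂_comp_left (σ : C.functionField →+* C.functionField) _ _ _).trans (by
      congr 1
      ext a
      simp)
  rw [h2]
  have h3 := aeval_algebraMap_apply C.ConeField (fun i => σ (C.coordQuot i 2)) P
  refine h3.symm.trans ?_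
  rw [proj_aeval, ← aeval_div_of_isHomogeneous hP]
  congr 2
  ext i
  exact hσ i 2

/-- The equation represents the function `0`, which `σ` maps to `0`. -/
theorem IsInducedBy.poly_dvd {σ : C.Aut} {M : GL (Fin 3) K}
    (hσ : C.IsInducedBy σ (M : Matrix (Fin 3) (Fin 3) K)) (hd : 2 ≤ C.degree) :
    C.poly ∣ aeval (linForm (M : Matrix (Fin 3) (Fin 3) K)) C.poly := by
  have h := hσ.coe_apply_eq C.isHomogeneous 0 (by rw [proj_poly, zero_div]; rfl)
  rw [map_zero, ZeroMemClass.coe_zero, eq_comm, div_eq_zero_iff] at h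
  exact (proj_eq_zero_iff _ _).1
    (h.resolve_right (pow_ne_zero _ (proj_linForm_ne_zero hd M 2)))

theorem proj_div_pow_mem {P : MvPolynomial (Fin 3) K} {n : ℕ} (hP : P.IsHomogeneous n)
    (j : Fin 3) : C.proj P / C.coord j ^ n ∈ C.functionField := by
  have h : C.proj P / C.coord j ^ n =
      algebraMap C.functionField _ (aeval (fun i => C.coordQuot i j) P) := by
    rw [← aeval_coord, ← aeval_div_of_isHomogeneous hP]
    exact (aeval_algebraMap_apply C.ConeField (fun i => C.coordQuot i j) P)
  rw [h]
  exact SetLike.coe_mem _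

theorem coe_apply_eq_of_mem {σ : C.Aut} {E : IntermediateField K C.ConeField} {G : Subgroup C.Aut}
    (hE : E ≤ C.quotientField G) (hσ : σ ∈ G) (f : C.functionField) (hf : (f : C.ConeField) ∈ E) :
    σ f = f := by
  have h := hE hf
  rw [quotientField, IntermediateField.mem_lift] at h
  exact h ⟨σ, hσ⟩

theorem aut_ext {σ τ : C.Aut} (h : ∀ i j, σ (C.coordQuot i j) = τ (C.coordQuot i j)) :
    σ = τ := by
  apply AlgEquiv.coe_toAlgHom_injective
  refine IntermediateField.adjoin_algHom_ext K ?_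
  rintro _ ⟨i, j, rfl⟩
  exact h i j

/-- A linear automorphism is trivial if its matrix is scalar. -/
theorem IsInducedBy.eq_one_of_scalar {σ : C.Aut} {M : Matrix (Fin 3) (Fin 3) K}
    (hσ : C.IsInducedBy σ M) {c : K} (hc : c ≠ 0) (hM : ∀ i j, M i j = if i = j then c else 0) :
    σ = 1 := by
  have hl : ∀ i, C.proj (linForm M i) = algebraMap K _ c * C.coord i := by
    intro i
    rw [proj_linForm, Finset.sum_eq_single i]
    · rw [hM, if_pos rfl]
    · intro j _ hj
      rw [hM, if_neg hj.symm, map_zero, zero_mul]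
    · simp
  have hc' : algebraMap K C.ConeField c ≠ 0 := by simpa using hc
  have h : ∀ i j, σ (C.coordQuot i j) = C.coordQuot i j := fun i j => Subtype.ext (by
    rw [hσ i j, hl, hl, mul_div_mul_left _ _ hc']; rfl)
  exact aut_ext h

variable [IsAlgClosed K] {p r : ℕ} [Fact p.Prime] [CharP K p] {z : Fin 3 → C.ConeField}

/-- If the Gauss map is invariant under a linear automorphism, then all tangent lines are fixed by
the transposed linear map. -/
theorem IsInducedBy.exists_transpose_mulVec_gaussMap {σ : C.Aut} {M : GL (Fin 3) K}
    (hσ : C.IsInducedBy σ (M : Matrix (Fin 3) (Fin 3) K)) (hz : C.IsSeparableGaussMap p r z)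
    (hfix : ∀ f : C.functionField, (f : C.ConeField) ∈ C.imageField z → σ f = f) :
    ∃ c : K, ∀ j, ∑ i, algebraMap K C.ConeField ((M : Matrix (Fin 3) (Fin 3) K) i j) *
      C.gaussMap i = algebraMap K _ c * C.gaussMap j := by
  have hd := hz.two_le_degree
  obtain ⟨μ, hμ, hg⟩ := hz.exists_gaussMap_eq
  obtain ⟨l, hl⟩ := gaussMap_ne_zero (C := C) p
  set N := (M : Matrix (Fin 3) (Fin 3) K) with hN
  set γ : Fin 3 → C.ConeField := fun i => C.proj (aeval (linForm N) (pderiv i C.poly)) with hγ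
  have hx : C.coord 2 ^ (C.degree - 1) ≠ 0 := pow_ne_zero _ (coord_ne_zero hd 2)
  have hlx : C.proj (linForm N 2) ^ (C.degree - 1) ≠ 0 :=
    pow_ne_zero _ (proj_linForm_ne_zero hd M 2)
  -- the affine Gauss map
  let g : Fin 3 → C.functionField := fun i =>
    ⟨_, proj_div_pow_mem (C.isHomogeneous.pderiv (i := i)) 2⟩
  have hgv : ∀ i, (g i : C.ConeField) = C.gaussMap i / C.coord 2 ^ (C.degree - 1) := fun _ => rfl
  have hσg : ∀ i, (σ (g i) : C.ConeField) = γ i / C.proj (linForm N 2) ^ (C.degree - 1) :=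
    fun i => hσ.coe_apply_eq C.isHomogeneous.pderiv (g i) rfl
  have hgl : g l ≠ 0 := by
    intro h
    have := congrArg (Subtype.val) h
    rw [show (g l).val = _ from hgv l] at this
    exact div_ne_zero hl hx this
  have hγl : γ l ≠ 0 := by
    intro h
    have h1 := hσg l
    rw [h, zero_div] at h1
    exact hgl ((map_eq_zero σ).1 (Subtype.ext h1))
  -- Here `γ` is the Gauss map composed with `M`; the ratios are invariant because they are the `p ^
  -- r`-th powers of the `z i / z l`.
  have hratio : ∀ i, γ i * C.gaussMap l = γ l * C.gaussMap i := by
    intro i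
    have h1 : σ (g i / g l) = g i / g l := by
      apply hfix
      have : ((g i / g l : C.functionField) : C.ConeField) = (z i / z l) ^ p ^ r := by
        have : ((g i / g l : C.functionField) : C.ConeField) = g i / g l := rfl
        rw [this, hgv, hgv, div_div_div_cancel_right₀ hx, hg, hg, mul_div_mul_left _ _ hμ, div_pow]
      rw [this]
      have hm : z i / z l ∈ C.imageField z := IntermediateField.subset_adjoin K _ ⟨i, l, rfl⟩
      exact pow_mem hm _
    rw [map_div₀] at h1
    have h2 : (σ (g i) : C.ConeField) / σ (g l) = g i / g l := congrArg Subtype.val h1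
    rw [hgv, hgv, hσg, hσg, div_div_div_cancel_right₀ hx, div_div_div_cancel_right₀ hlx,
      div_eq_div_iff hγl hl] at h2
    rw [h2, mul_comm]
  obtain ⟨H, hH⟩ := hσ.poly_dvd hd
  -- Differentiate `F ∘ M = F * H`; the term containing `∂H` vanishes on the curve.
  have hchain : ∀ j, ∑ i, algebraMap K C.ConeField (N i j) * γ i = C.proj H * C.gaussMap j := by
    intro j
    have h := congrArg C.proj (congrArg (pderiv j) hH)
    rw [pderiv_aeval, pderiv_mul, map_add, map_mul, map_mul, proj_poly, zero_mul, add_zero,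
      map_sum] at h
    rw [gaussMap, mul_comm, ← h]
    refine Finset.sum_congr rfl fun i _ => ?_
    rw [pderiv_linForm, map_mul, mul_comm, ← algebraMap_eq, AlgHom.commutes]
  set lam := C.proj H * C.gaussMap l / γ l with hlam
  have heig : ∀ j, ∑ i, algebraMap K C.ConeField (N i j) * C.gaussMap i = lam * C.gaussMap j := by
    intro j
    rw [hlam, div_mul_eq_mul_div, eq_div_iff hγl, mul_right_comm, ← hchain, Finset.sum_mul,
      Finset.sum_mul]
    refine Finset.sum_congr rfl fun i _ => ?_
    rw [mul_assoc, mul_assoc, hratio, mul_comm (γ l)]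
  -- The eigenvalue is a root of the characteristic polynomial of `N`, whose coefficients lie in
  -- `K`.
  have halg : IsAlgebraic K lam := by
    have hev : Module.End.HasEigenvalue
        (Matrix.toLin' (N.map (algebraMap K C.ConeField))ᵀ) lam := by
      refine Module.End.hasEigenvalue_of_hasEigenvector (x := C.gaussMap)
        (Module.End.hasEigenvector_iff.2
          ⟨Module.End.mem_eigenspace_iff.2 ?_, fun h => hl (congrFun h l)⟩)
      ext j
      simpa [Matrix.mulVec, dotProduct] using heig j
    have hroot := (Module.End.hasEigenvalue_iff_isRoot_charpoly _ _).1 hev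
    rw [Matrix.charpoly_toLin', Matrix.charpoly_transpose, Matrix.charpoly_map] at hroot
    refine ⟨N.charpoly, (Matrix.charpoly_monic N).ne_zero, ?_⟩
    rwa [Polynomial.IsRoot, Polynomial.eval_map_algebraMap] at hroot
  obtain ⟨c, hc⟩ := mem_range_of_isAlgebraic halg
  exact ⟨c, fun j => by rw [hc, heig]⟩


end PlaneCurve

/-! ### Strangeness and the normal form of the matrices. -/

namespace PlaneCurve

open MvPolynomial Matrix

variable {K : Type*} [Field K] {C : PlaneCurve K}

theorem eq_zero_of_vecMul_map_eq_zero {A : Type*} [Field A] [Algebra K A] (M : GL (Fin 3) K)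
    {v : Fin 3 → A}
    (h : v ᵥ* (M : Matrix (Fin 3) (Fin 3) K).map (algebraMap K A) = 0) : v = 0 := by
  refine Matrix.eq_zero_of_vecMul_eq_zero ?_ h
  rw [← RingHom.mapMatrix_apply, ← RingHom.map_det, map_ne_zero]
  exact ((Matrix.isUnit_iff_isUnit_det _).1 M.isUnit).ne_zero

theorem IsInducedBy.of_smul {σ : C.Aut} {M N : Matrix (Fin 3) (Fin 3) K}
    (hσ : C.IsInducedBy σ M) {c : K} (hc : c ≠ 0) (hN : M = c • N) : C.IsInducedBy σ N := by
  have hc' : algebraMap K C.ConeField c ≠ 0 := by simpa using hc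
  have h : ∀ i, C.proj (linForm M i) = algebraMap K _ c * C.proj (linForm N i) := by
    intro i
    simp only [proj_linForm, hN, Matrix.smul_apply, smul_eq_mul, map_mul, Finset.mul_sum, mul_assoc]
  intro i j
  rw [hσ i j, h, h, mul_div_mul_left _ _ hc']

/-- The first column of `T` is the image of `(1 : 0 : 0)`, so `T` moves this point to `a`. -/
theorem exists_GL_col_eq (a : Fin 3 → K) (ha : a ≠ 0) :
    ∃ T : GL (Fin 3) K, ∀ i, (T : Matrix (Fin 3) (Fin 3) K) i 0 = a i := by
  by_cases h0 : a 0 = 0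
  · by_cases h1 : a 1 = 0
    · have h2 : a 2 ≠ 0 := by
        intro h2
        apply ha
        ext i
        fin_cases i <;> assumption
      refine ⟨GeneralLinearGroup.mkOfDetNeZero !![a 0, 1, 0; a 1, 0, 1; a 2, 0, 0]
        (by simpa [Matrix.det_fin_three] using h2), fun i => ?_⟩
      fin_cases i <;> rfl
    · refine ⟨GeneralLinearGroup.mkOfDetNeZero !![a 0, 1, 0; a 1, 0, 0; a 2, 0, 1]
        (by simpa [Matrix.det_fin_three] using h1), fun i => ?_⟩
      fin_cases i <;> rfl
  · refine ⟨GeneralLinearGroup.mkOfDetNeZero !![a 0, 0, 0; a 1, 1, 0; a 2, 0, 1]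
      (by simpa [Matrix.det_fin_three] using h0), fun i => ?_⟩
    fin_cases i <;> rfl

/-- With `g 0 = 0`, a nontrivial relation between `g 1` and `g 2` makes `g` a multiple of a constant
vector. -/
theorem eq_zero_of_ne_mul_const {A : Type*} [Field A] [Algebra K A] {g : Fin 3 → A}
    (hg : ∀ (w : A) (c : Fin 3 → K), ∃ i, g i ≠ algebraMap K _ (c i) * w) (h0 : g 0 = 0)
    {α β : K} (h : algebraMap K A α * g 1 + algebraMap K A β * g 2 = 0) : α = 0 ∧ β = 0 := by
  by_cases hα : α = 0
  · refine ⟨hα, ?_⟩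
    by_contra hβ
    rw [hα, map_zero, zero_mul, zero_add, mul_eq_zero, map_eq_zero, or_iff_right hβ] at h
    obtain ⟨i, hi⟩ := hg (g 1) ![0, 1, 0]
    fin_cases i <;> simp_all
  · exfalso
    obtain ⟨i, hi⟩ := hg (g 2) ![0, - β / α, 1]
    have hα' : algebraMap K A α ≠ 0 := by simpa using hα
    fin_cases i
    · simp [h0] at hi
    · apply hi
      have h1 : g 1 = -(algebraMap K A β / algebraMap K A α) * g 2 := by
        field_simp
        linear_combination h
      simpa [neg_div] using h1
    · simp at hi

variable [IsAlgClosed K] {p r : ℕ} [Fact p.Prime] [CharP K p] {z : Fin 3 → C.ConeField}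

/-- If the Gauss map is invariant under a nontrivial linear automorphism, then the curve is
strange: its tangent lines have a common point. -/
theorem IsInducedBy.exists_sum_mul_gaussMap_eq_zero {σ : C.Aut} {M : GL (Fin 3) K}
    (hσ : C.IsInducedBy σ (M : Matrix (Fin 3) (Fin 3) K)) (hz : C.IsSeparableGaussMap p r z)
    (hfix : ∀ f : C.functionField, (f : C.ConeField) ∈ C.imageField z → σ f = f) (hne : σ ≠ 1) :
    ∃ a : Fin 3 → K, a ≠ 0 ∧ ∑ i, algebraMap K C.ConeField (a i) * C.gaussMap i = 0 := by
  obtain ⟨c, hc⟩ := hσ.exists_transpose_mulVec_gaussMap hz hfix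
  by_contra! h
  have hM : ∀ j, (fun i => (M : Matrix (Fin 3) (Fin 3) K) i j - if i = j then c else 0) = 0 := by
    intro j
    by_contra hj
    apply h _ hj
    simp only [map_sub, sub_mul, Finset.sum_sub_distrib, hc]
    rw [Finset.sum_eq_single (f := fun i => algebraMap K C.ConeField (if i = j then c else 0) *
      C.gaussMap i) j (fun i _ hi => by simp [hi]) (by simp), if_pos rfl, sub_self]
  refine hne (hσ.eq_one_of_scalar (c := c) ?_ fun i j => sub_eq_zero.1 (congrFun (hM j) i))
  -- A zero eigenvalue is impossible because `M` is invertible and `γ ≠ 0`.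
  rintro rfl
  obtain ⟨i, hi⟩ := gaussMap_ne_zero (C := C) p
  refine hi (congrFun (eq_zero_of_vecMul_map_eq_zero M (v := C.gaussMap) ?_) i)
  ext j
  have := hc j
  rw [map_zero, zero_mul] at this
  simpa [Matrix.vecMul, dotProduct, mul_comm] using this

/-- The Gauss map in the coordinates given by `T`. -/
noncomputable def gaussMapIn (C : PlaneCurve K) (T : GL (Fin 3) K) : Fin 3 → C.ConeField :=
  C.gaussMap ᵥ* (T : Matrix (Fin 3) (Fin 3) K).map (algebraMap K _)

theorem IsSeparableGaussMap.gaussMapIn_ne_mul_const (hz : C.IsSeparableGaussMap p r z)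
    (T : GL (Fin 3) K) (w : C.ConeField) (c : Fin 3 → K) :
    ∃ i, C.gaussMapIn T i ≠ algebraMap K _ (c i) * w := by
  by_contra! h
  obtain ⟨i, hi⟩ := hz.gaussMap_ne_mul_const w
    (c ᵥ* ((T⁻¹ : GL (Fin 3) K) : Matrix (Fin 3) (Fin 3) K))
  apply hi
  have h1 : C.gaussMap = C.gaussMapIn T ᵥ*
      ((T⁻¹ : GL (Fin 3) K) : Matrix (Fin 3) (Fin 3) K).map (algebraMap K _) := by
    rw [gaussMapIn, Matrix.vecMul_vecMul, ← Matrix.map_mul, ← Units.val_mul, mul_inv_cancel,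
      Units.val_one, Matrix.map_one _ (map_zero _) (map_one _), Matrix.vecMul_one]
  rw [h1]
  simp only [Matrix.vecMul, dotProduct, h, Matrix.map_apply, map_sum, map_mul, Finset.sum_mul]
  exact Finset.sum_congr rfl fun _ _ => by ring

/-- In the new coordinates `g` is a left eigenvector of `N = T⁻¹ M T` with eigenvalue `c`. Since `g
0 = 0` and `g 1`, `g 2` are independent over `K`, comparing columns gives the last two rows of `N`
as `(0, c, 0)` and `(0, 0, c)`; dividing by `c` normalizes them. -/
theorem IsInducedBy.exists_conj {σ : C.Aut} {M : GL (Fin 3) K}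
    (hσ : C.IsInducedBy σ (M : Matrix (Fin 3) (Fin 3) K)) (hz : C.IsSeparableGaussMap p r z)
    (hfix : ∀ f : C.functionField, (f : C.ConeField) ∈ C.imageField z → σ f = f)
    (T : GL (Fin 3) K) (hT : C.gaussMapIn T 0 = 0) :
    ∃ a b c : K, a ≠ 0 ∧ C.IsInducedBy σ
      ((T : Matrix (Fin 3) (Fin 3) K) * !![a, b, c; 0, 1, 0; 0, 0, 1] *
        ((T⁻¹ : GL (Fin 3) K) : Matrix (Fin 3) (Fin 3) K)) := by
  obtain ⟨c, hc⟩ := hσ.exists_transpose_mulVec_gaussMap hz hfix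
  set g := C.gaussMapIn T with hg
  set N : GL (Fin 3) K := T⁻¹ * M * T with hN
  have hc' : C.gaussMap ᵥ* (M : Matrix (Fin 3) (Fin 3) K).map (algebraMap K _) =
      algebraMap K C.ConeField c • C.gaussMap := by
    ext j
    simpa [Matrix.vecMul, dotProduct, mul_comm] using hc j
  have hgN : g ᵥ* (N : Matrix (Fin 3) (Fin 3) K).map (algebraMap K _) =
      algebraMap K C.ConeField c • g := by
    rw [hg, gaussMapIn, Matrix.vecMul_vecMul, ← Matrix.map_mul, ← Units.val_mul, hN,
      mul_assoc, mul_inv_cancel_left, Units.val_mul, Matrix.map_mul, ← Matrix.vecMul_vecMul, hc',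
      Matrix.smul_vecMul]
  have hcol : ∀ j, algebraMap K C.ConeField ((N : Matrix (Fin 3) (Fin 3) K) 1 j) * g 1 +
      algebraMap K C.ConeField ((N : Matrix (Fin 3) (Fin 3) K) 2 j) * g 2 =
      algebraMap K C.ConeField c * g j := by
    intro j
    have := congrFun hgN j
    simp only [Matrix.vecMul, dotProduct, Fin.sum_univ_three, hT, Matrix.map_apply, zero_mul,
      zero_add, Pi.smul_apply, smul_eq_mul] at this
    rw [← this]
    ring
  have hne := hz.gaussMapIn_ne_mul_const T
  obtain ⟨h10, h20⟩ := eq_zero_of_ne_mul_const hne hT (by rw [← hg, hcol 0, hT, mul_zero])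
  obtain ⟨h11, h21⟩ := eq_zero_of_ne_mul_const hne hT
    (α := (N : Matrix (Fin 3) (Fin 3) K) 1 1 - c) (β := (N : Matrix (Fin 3) (Fin 3) K) 2 1)
    (by rw [← hg, map_sub]; linear_combination hcol 1)
  obtain ⟨h12, h22⟩ := eq_zero_of_ne_mul_const hne hT
    (α := (N : Matrix (Fin 3) (Fin 3) K) 1 2) (β := (N : Matrix (Fin 3) (Fin 3) K) 2 2 - c)
    (by rw [← hg, map_sub]; linear_combination hcol 2)
  rw [sub_eq_zero] at h11 h22
  have hdet := ((Matrix.isUnit_iff_isUnit_det _).1 N.isUnit).ne_zero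
  rw [Matrix.det_fin_three, h10, h20, h21, h12, h11, h22] at hdet
  have hc0 : c ≠ 0 := by rintro rfl; simp at hdet
  have ha0 : (N : Matrix (Fin 3) (Fin 3) K) 0 0 ≠ 0 := by
    intro h
    simp [h] at hdet
  refine ⟨(N : Matrix (Fin 3) (Fin 3) K) 0 0 / c, (N : Matrix (Fin 3) (Fin 3) K) 0 1 / c,
    (N : Matrix (Fin 3) (Fin 3) K) 0 2 / c, div_ne_zero ha0 hc0, hσ.of_smul hc0 ?_⟩
  have hM : M = T * N * T⁻¹ := by rw [hN]; group
  rw [← Matrix.smul_mul, ← Matrix.mul_smul, hM, Units.val_mul, Units.val_mul]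
  congr 2
  ext i j
  fin_cases i <;> fin_cases j <;> simp [h10, h20, h21, h12, h11, h22, mul_div_cancel₀, hc0]

end PlaneCurve

/-! ### Projective changes of coordinates and the forms `Z₁`, `Z₂`. -/

namespace PlaneCurve

open MvPolynomial Matrix

variable {K : Type*} [Field K]

theorem isSeparable_map {A B : Type*} [Field A] [Field B] [Algebra K A] [Algebra K B]
    (φ : A →ₐ[K] B) {E : IntermediateField K A} {E' : IntermediateField K B}
    (hE : E.map φ ≤ E') {f : A} (hf : IsSeparable E f) : IsSeparable E' (φ f) := by
  let ι : E →+* E' := RingHom.codRestrict ((φ : A →+* B).comp (algebraMap E A)) E'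
    fun e => hE ⟨e, e.2, rfl⟩
  have hι : (algebraMap E' B).comp ι = (φ : A →+* B).comp (algebraMap E A) := rfl
  have hsep : ((minpoly E f).map ι).Separable := Polynomial.Separable.map hf
  refine hsep.of_dvd (minpoly.dvd _ _ ?_)
  rw [Polynomial.aeval_def, Polynomial.eval₂_map, hι]
  have h := congrArg φ (minpoly.aeval E f)
  rw [map_zero, Polynomial.aeval_def] at h
  rw [← h]
  exact (Polynomial.hom_eval₂ _ _ (φ : A →+* B) _).symm

variable (C : PlaneCurve K)

theorem exists_proj_div_eq (f : C.ConeField) (hf : f ∈ C.functionField) :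
    ∃ (n : ℕ) (P Q : MvPolynomial (Fin 3) K), P.IsHomogeneous n ∧ Q.IsHomogeneous n ∧
      C.proj Q ≠ 0 ∧ f = C.proj P / C.proj Q := by
  rw [functionField, imageField] at hf
  induction hf using IntermediateField.adjoin_induction with
  | mem f hf =>
    obtain ⟨i, j, rfl⟩ := hf
    by_cases h : C.coord j = 0
    · exact ⟨0, 0, 1, isHomogeneous_zero _ _ _, isHomogeneous_one _ _, by simp, by simp [h]⟩
    · exact ⟨1, X i, X j, isHomogeneous_X _ _, isHomogeneous_X _ _, h, rfl⟩
  | algebraMap a =>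
    refine ⟨0, MvPolynomial.C a, 1, isHomogeneous_C _ _, isHomogeneous_one _ _, by simp, ?_⟩
    rw [map_one, div_one]
    exact (C.proj.commutes a).symm
  | add f g _ _ hf hg =>
    obtain ⟨n, P, Q, hP, hQ, hQ0, rfl⟩ := hf
    obtain ⟨m, P', Q', hP', hQ', hQ0', rfl⟩ := hg
    refine ⟨n + m, P * Q' + Q * P', Q * Q', (hP.mul hQ').add (hQ.mul hP'), hQ.mul hQ', ?_, ?_⟩
    · rw [map_mul]; exact mul_ne_zero hQ0 hQ0'
    · rw [div_add_div _ _ hQ0 hQ0']; simp only [map_add, map_mul]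
  | inv f _ hf =>
    obtain ⟨n, P, Q, hP, hQ, hQ0, rfl⟩ := hf
    by_cases h : C.proj P = 0
    · exact ⟨n, P, Q, hP, hQ, hQ0, by rw [h, zero_div, _root_.inv_zero]⟩
    · exact ⟨n, Q, P, hQ, hP, h, inv_div _ _⟩
  | mul f g _ _ hf hg =>
    obtain ⟨n, P, Q, hP, hQ, hQ0, rfl⟩ := hf
    obtain ⟨m, P', Q', hP', hQ', hQ0', rfl⟩ := hg
    refine ⟨n + m, P * P', Q * Q', hP.mul hP', hQ.mul hQ', ?_, ?_⟩
    · rw [map_mul]; exact mul_ne_zero hQ0 hQ0'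
    · rw [div_mul_div_comm]; simp only [map_mul]

/-- Applied to an invertible matrix and to its inverse, this shows that image fields do not depend
on the coordinates. -/
theorem imageField_vecMul_le (v : Fin 3 → C.ConeField) (A : Matrix (Fin 3) (Fin 3) K) :
    C.imageField (v ᵥ* A.map (algebraMap K _)) ≤ C.imageField v := by
  rw [imageField, IntermediateField.adjoin_le_iff]
  rintro _ ⟨i, j, rfl⟩
  rw [SetLike.mem_coe]
  by_cases hv : v = 0
  · simp [hv, zero_mem]
  obtain ⟨l, hl⟩ := Function.ne_iff.1 hv
  have hl : v l ≠ 0 := hl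
  rw [← div_div_div_cancel_right₀ hl]
  have h : ∀ i, (v ᵥ* A.map (algebraMap K _)) i / v l ∈ C.imageField v := by
    intro i
    simp only [Matrix.vecMul, dotProduct, Finset.sum_div]
    refine sum_mem fun k _ => ?_
    rw [mul_div_right_comm]
    have hm : v k / v l ∈ C.imageField v := IntermediateField.subset_adjoin K _ ⟨k, l, rfl⟩
    exact mul_mem hm (IntermediateField.algebraMap_mem _ _)
  exact div_mem (h i) (h j)

variable {C} {p r : ℕ} {z : Fin 3 → C.ConeField}

theorem IsSeparableGaussMap.of_eq_mul (hz : C.IsSeparableGaussMap p r z) {s : C.ConeField}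
    (hs : s ≠ 0) {w : Fin 3 → C.ConeField} (hw : ∀ i, w i = s * z i) :
    C.IsSeparableGaussMap p r w := by
  have h : C.imageField w = C.imageField z := by
    simp only [imageField, hw, mul_div_mul_left _ _ hs]
  refine ⟨fun h0 => hz.1 ?_, h ▸ hz.2.1, fun i j => ?_, h ▸ hz.2.2.2⟩
  · ext i
    have := congrFun h0 i
    rw [hw] at this
    exact (mul_eq_zero.1 this).resolve_left hs
  · rw [hw, hw, mul_pow, mul_pow]
    linear_combination s ^ p ^ r * hz.2.2.1 i j

section Transform

variable (C) (T : GL (Fin 3) K)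

/-- The curve with the equation `F (T (X, Y, Z)) = 0`. -/
noncomputable def transform : PlaneCurve K where
  poly := linEquiv T C.poly
  degree := C.degree
  isHomogeneous := IsHomogeneous.aeval_linForm C.isHomogeneous _
  irreducible := (MulEquiv.irreducible_iff (linEquiv T)).2 C.irreducible

theorem transform_isTransformOf : (C.transform T).IsTransformOf C T := rfl

/-- The map of the homogeneous coordinate rings given by `T`. -/
noncomputable def transformCoordRingHom : C.CoordRing →ₐ[K] (C.transform T).ConeField :=
  Ideal.Quotient.liftₐ (Ideal.span {C.poly})
    ((C.transform T).proj.comp (linEquiv T : MvPolynomial (Fin 3) K →ₐ[K] _))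
    (by
      intro P hP
      rw [Ideal.mem_span_singleton] at hP
      exact ((C.transform T).proj_eq_zero_iff _).2 (map_dvd (linEquiv T) hP))

theorem transformCoordRingHom_injective : Function.Injective (C.transformCoordRingHom T) := by
  rw [injective_iff_map_eq_zero]
  intro x hx
  obtain ⟨P, rfl⟩ := Ideal.Quotient.mk_surjective x
  have h : (C.transform T).proj (linEquiv T P) = 0 := hx
  rw [proj_eq_zero_iff] at h
  rw [Ideal.Quotient.eq_zero_iff_mem, Ideal.mem_span_singleton]
  exact (map_dvd_iff (linEquiv T)).1 h

/-- The map of the fraction fields of the homogeneous coordinate rings given by `T`. -/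
noncomputable def transformHom : C.ConeField →ₐ[K] (C.transform T).ConeField :=
  IsFractionRing.liftAlgHom (C.transformCoordRingHom_injective T)

theorem transformHom_proj (P : MvPolynomial (Fin 3) K) :
    C.transformHom T (C.proj P) = (C.transform T).proj (linEquiv T P) :=
  IsFractionRing.lift_algebraMap (C.transformCoordRingHom_injective T) _

theorem transformHom_coord (i : Fin 3) :
    C.transformHom T (C.coord i) =
      ((C.transform T).coord ᵥ* ((T : Matrix (Fin 3) (Fin 3) K)ᵀ).map (algebraMap K _)) i := by
  rw [coord, transformHom_proj, linEquiv_apply, aeval_X, proj_linForm]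
  simp [Matrix.vecMul, dotProduct, mul_comm]

theorem transform_coord :
    (C.transform T).coord = (fun i => C.transformHom T (C.coord i)) ᵥ*
      (((T⁻¹ : GL (Fin 3) K) : Matrix (Fin 3) (Fin 3) K)ᵀ).map (algebraMap K _) := by
  rw [funext (C.transformHom_coord T), Matrix.vecMul_vecMul, ← Matrix.map_mul,
    ← Matrix.transpose_mul, ← Units.val_mul, inv_mul_cancel, Units.val_one, Matrix.transpose_one,
    Matrix.map_one _ (map_zero _) (map_one _), Matrix.vecMul_one]

theorem map_transformHom_imageField (v : Fin 3 → C.ConeField) :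
    (C.imageField v).map (C.transformHom T) =
      (C.transform T).imageField fun i => C.transformHom T (v i) := by
  rw [imageField, IntermediateField.adjoin_map, imageField]
  congr 1
  ext f
  constructor
  · rintro ⟨_, ⟨i, j, rfl⟩, rfl⟩
    exact ⟨i, j, map_div₀ _ _ _⟩
  · rintro ⟨i, j, rfl⟩
    exact ⟨_, ⟨i, j, rfl⟩, map_div₀ _ _ _⟩

theorem map_transformHom_functionField :
    C.functionField.map (C.transformHom T) = (C.transform T).functionField := by
  rw [functionField, map_transformHom_imageField]
  apply le_antisymm
  · rw [funext (C.transformHom_coord T)]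
    exact imageField_vecMul_le _ _ _
  · rw [functionField, transform_coord]
    exact imageField_vecMul_le _ _ _

theorem transform_gaussMap (j : Fin 3) :
    (C.transform T).gaussMap j = C.transformHom T (C.gaussMapIn T j) := by
  change (C.transform T).proj (pderiv j (aeval (linForm T) C.poly)) = _
  rw [pderiv_aeval, map_sum, gaussMapIn, Matrix.vecMul, dotProduct, map_sum]
  refine Finset.sum_congr rfl fun i _ => ?_
  rw [pderiv_linForm, map_mul, map_mul, gaussMap, transformHom_proj, linEquiv_apply,
    Matrix.map_apply, AlgHom.commutes, ← algebraMap_eq, AlgHom.commutes]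

variable {C} [PerfectRing K p] [Fact p.Prime] [CharP K p]

/-- A separable Gauss map in the coordinates given by `T`. -/
theorem IsSeparableGaussMap.exists_transform (hz : C.IsSeparableGaussMap p r z) :
    ∃ w, (C.transform T).IsSeparableGaussMap p r w := by
  obtain ⟨μ, hμ, hg⟩ := hz.exists_gaussMap_eq
  -- The `p ^ r`-th powers of the new components must transform by `T`, so the components themselves
  -- transform by the `p ^ r`-th roots of its entries.
  let S : GL (Fin 3) K :=
    Matrix.GeneralLinearGroup.map ((iterateFrobeniusEquiv K p r).symm : K →+* K) T
  set φz : Fin 3 → (C.transform T).ConeField := fun i => C.transformHom T (z i) with hφz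
  set w := φz ᵥ* (S : Matrix (Fin 3) (Fin 3) K).map (algebraMap K _) with hw
  have hφw : φz = w ᵥ* ((S⁻¹ : GL (Fin 3) K) : Matrix (Fin 3) (Fin 3) K).map (algebraMap K _) := by
    rw [hw, Matrix.vecMul_vecMul, ← Matrix.map_mul, ← Units.val_mul, mul_inv_cancel,
      Units.val_one, Matrix.map_one _ (map_zero _) (map_one _), Matrix.vecMul_one]
  have himage : (C.imageField z).map (C.transformHom T) = (C.transform T).imageField w := by
    rw [map_transformHom_imageField]
    apply le_antisymm
    · change (C.transform T).imageField φz ≤ _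
      rw [hφw]
      exact imageField_vecMul_le _ _ _
    · exact imageField_vecMul_le _ _ _
  have : CharP (C.transform T).ConeField p := charP_of_injective_algebraMap' K p
  have hgw : ∀ j, (C.transform T).gaussMap j = C.transformHom T μ * w j ^ p ^ r := by
    intro j
    rw [transform_gaussMap, gaussMapIn, hw]
    simp only [Matrix.vecMul, dotProduct, map_sum, Matrix.map_apply]
    rw [sum_pow_char_pow, Finset.mul_sum]
    refine Finset.sum_congr rfl fun i _ => ?_
    have hS : (S : Matrix (Fin 3) (Fin 3) K) i j ^ p ^ r =
        (T : Matrix (Fin 3) (Fin 3) K) i j :=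
      (iterateFrobeniusEquiv K p r).apply_symm_apply _
    rw [map_mul, hg, map_mul, map_pow, AlgHom.commutes, mul_pow, ← hS, map_pow, mul_assoc]
  refine ⟨w, ?_, ?_, ?_, ?_⟩
  · intro h0
    obtain ⟨j, hj⟩ := gaussMap_ne_zero (C := C.transform T) p
    apply hj
    rw [hgw, h0, Pi.zero_apply, zero_pow (pow_ne_zero _ (Fact.out : p.Prime).ne_zero), mul_zero]
  · rw [← himage, ← map_transformHom_functionField]
    exact IntermediateField.map_mono _ hz.2.1
  · intro i j
    rw [hgw, hgw]
    ring
  · intro f hf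
    rw [← map_transformHom_functionField] at hf
    obtain ⟨f, hf, rfl⟩ := hf
    exact isSeparable_map (C.transformHom T) himage.le (hz.2.2.2 f hf)

end Transform

section Strange

variable [IsAlgClosed K] [Fact p.Prime] [CharP K p]

/-- Write `z 1 / z 2` as a quotient `P / Q` of forms of equal degree and rescale `z` by `Q / z 2`.
Euler's relation, with the common factor of `γ` cancelled, is the divisibility. -/
theorem IsSeparableGaussMap.exists_forms (hz : C.IsSeparableGaussMap p r z)
    (h0 : C.gaussMap 0 = 0) :
    ∃ (m : ℕ) (Z₁ Z₂ : MvPolynomial (Fin 3) K),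
      Z₁.IsHomogeneous m ∧ Z₂.IsHomogeneous m ∧
      C.IsSeparableGaussMap p r ![0, C.proj Z₁, C.proj Z₂] ∧
      C.poly ∣ Z₁ ^ p ^ r * X 1 + Z₂ ^ p ^ r * X 2 := by
  obtain ⟨μ, hμ, hg⟩ := hz.exists_gaussMap_eq
  have hq : p ^ r ≠ 0 := pow_ne_zero _ (Fact.out : p.Prime).ne_zero
  have hz0 : z 0 = 0 := by
    rw [hg, mul_eq_zero, or_iff_right hμ] at h0
    exact eq_zero_of_pow_eq_zero h0
  have hz2 : z 2 ≠ 0 := by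
    intro h
    have := eq_zero_of_ne_mul_const (K := K) hz.ne_mul_const hz0 (α := 0) (β := 1)
      (by simp [h])
    exact one_ne_zero this.2
  have hmem : z 1 / z 2 ∈ C.functionField :=
    hz.2.1 (IntermediateField.subset_adjoin K _ ⟨1, 2, rfl⟩)
  obtain ⟨m, P, Q, hP, hQ, hQ0, hPQ⟩ := C.exists_proj_div_eq _ hmem
  have hw : ∀ i, ![0, C.proj P, C.proj Q] i = C.proj Q / z 2 * z i := by
    intro i
    fin_cases i
    · simp [hz0]
    · rw [div_eq_div_iff hz2 hQ0] at hPQ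
      change C.proj P = C.proj Q / z 2 * z 1
      field_simp
      linear_combination -hPQ
    · exact (div_mul_cancel₀ _ hz2).symm
  have hz' := hz.of_eq_mul (div_ne_zero hQ0 hz2) hw
  refine ⟨m, P, Q, hP, hQ, hz', ?_⟩
  obtain ⟨μ', hμ', hg'⟩ := hz'.exists_gaussMap_eq
  rw [← proj_eq_zero_iff]
  have he := sum_coord_mul_gaussMap (C := C)
  rw [Fin.sum_univ_three, h0, mul_zero, zero_add, hg' 1, hg' 2] at he
  change C.coord 1 * (μ' * C.proj P ^ p ^ r) + C.coord 2 * (μ' * C.proj Q ^ p ^ r) = 0 at he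
  rw [map_add, map_mul, map_mul, map_pow, map_pow]
  change C.proj P ^ p ^ r * C.coord 1 + C.proj Q ^ p ^ r * C.coord 2 = 0
  apply (mul_eq_zero.1 (_ : μ' * _ = 0)).resolve_left hμ'
  linear_combination he

end Strange

end PlaneCurve

/-! ### Inseparability, with the derivation `∂/∂X` encoded in the dual numbers. -/

namespace PlaneCurve

open MvPolynomial

variable {K : Type*} [Field K] {C : PlaneCurve K} {p r : ℕ} {z : Fin 3 → C.ConeField}

/-- First-order Taylor expansion in the variable `X 0`. -/
theorem aeval_add_eps {A : Type*} [CommRing A] [Algebra K A] (x : Fin 3 → A)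
    (P : MvPolynomial (Fin 3) K) :
    aeval (fun i => TrivSqZeroExt.inl (x i) + TrivSqZeroExt.inr (if i = 0 then 1 else 0)) P =
      (TrivSqZeroExt.inl (aeval x P) + TrivSqZeroExt.inr (aeval x (pderiv 0 P)) :
        TrivSqZeroExt A A) := by
  induction P using MvPolynomial.induction_on with
  | C a =>
    simp only [algHom_C, pderiv_C, map_zero, TrivSqZeroExt.inr_zero, add_zero]
    rfl
  | add P Q hP hQ =>
    simp only [map_add, hP, hQ, TrivSqZeroExt.inl_add, TrivSqZeroExt.inr_add]
    ring
  | mul_X P n hP =>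
    simp only [map_mul, aeval_X, hP, pderiv_mul, pderiv_X, map_add]
    by_cases hn : n = 0
    · subst hn
      ext
      · simp
      · simp
        ring
    · ext
      · simp [hn]
      · simp [hn, mul_comm]

/-- A derivation is a homomorphism `f ↦ f + ε f'`. In this form `∂/∂X` descends to the quotient and
extends to the fraction field by universal properties, since a dual number with nonzero constant
part is a unit. -/
theorem exists_algHom_dualNumber {I : Ideal (MvPolynomial (Fin 3) K)} [I.IsPrime]
    {L : Type*} [Field L] [Algebra K L] [Algebra (MvPolynomial (Fin 3) K ⧸ I) L]
    [IsScalarTower K (MvPolynomial (Fin 3) K ⧸ I) L]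
    [IsFractionRing (MvPolynomial (Fin 3) K ⧸ I) L] (π : MvPolynomial (Fin 3) K →ₐ[K] L)
    (hπ : ∀ P, π P = algebraMap (MvPolynomial (Fin 3) K ⧸ I) L (Ideal.Quotient.mk I P))
    (hI : ∀ P ∈ I, π (pderiv 0 P) = 0) :
    ∃ ψ : L →ₐ[K] TrivSqZeroExt L L, ∀ i, ψ (π (X i)) =
        TrivSqZeroExt.inl (π (X i)) + TrivSqZeroExt.inr (if i = 0 then 1 else 0) := by
  let ψ₀ : MvPolynomial (Fin 3) K →ₐ[K] TrivSqZeroExt L L :=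
    aeval fun i => TrivSqZeroExt.inl (π (X i)) + TrivSqZeroExt.inr (if i = 0 then 1 else 0)
  have hψ₀ : ∀ P, ψ₀ P = TrivSqZeroExt.inl (π P) + TrivSqZeroExt.inr (π (pderiv 0 P)) := by
    intro P
    have hae : aeval (fun i => π (X i)) = π := by ext i; simp
    have h := aeval_add_eps (fun i => π (X i)) P
    rwa [hae] at h
  have hzero : ∀ P, π P = 0 ↔ P ∈ I := by
    intro P
    rw [hπ, map_eq_zero_iff _ (IsFractionRing.injective (MvPolynomial (Fin 3) K ⧸ I) L),
      Ideal.Quotient.eq_zero_iff_mem]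
  let ψ₁ : (MvPolynomial (Fin 3) K ⧸ I) →ₐ[K] TrivSqZeroExt L L :=
    Ideal.Quotient.liftₐ I ψ₀ fun P hP => by
      rw [hψ₀, (hzero P).2 hP, hI P hP, TrivSqZeroExt.inl_zero, TrivSqZeroExt.inr_zero, add_zero]
  have hunit : ∀ y : nonZeroDivisors (MvPolynomial (Fin 3) K ⧸ I), IsUnit (ψ₁ y) := by
    rintro ⟨y, hy⟩
    obtain ⟨P, rfl⟩ := Ideal.Quotient.mk_surjective y
    have h1 : ψ₁ (Ideal.Quotient.mk I P) = ψ₀ P := rfl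
    rw [h1, TrivSqZeroExt.isUnit_iff_isUnit_fst, hψ₀]
    simp only [TrivSqZeroExt.fst_add, TrivSqZeroExt.fst_inl, TrivSqZeroExt.fst_inr, add_zero]
    refine Ne.isUnit fun h => nonZeroDivisors.ne_zero hy ?_
    rwa [Ideal.Quotient.eq_zero_iff_mem, ← hzero]
  refine ⟨IsLocalization.liftAlgHom (M := nonZeroDivisors (MvPolynomial (Fin 3) K ⧸ I))
    (f := ψ₁) hunit, fun i => ?_⟩
  have h2 : IsLocalization.liftAlgHom (M := nonZeroDivisors (MvPolynomial (Fin 3) K ⧸ I))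
      (f := ψ₁) hunit (algebraMap _ L (Ideal.Quotient.mk I (X i))) =
      ψ₁ (Ideal.Quotient.mk I (X i)) := IsLocalization.lift_eq _ _
  have h3 : ψ₁ (Ideal.Quotient.mk I (X i)) = ψ₀ (X i) := rfl
  rw [← hπ] at h2
  rw [h2, h3]
  exact aeval_X _ _

/-- The subfield on which a homomorphism to the dual numbers is constant. -/
def constants {L : Type*} [Field L] [Algebra K L] (ψ : L →ₐ[K] TrivSqZeroExt L L) :
    IntermediateField K L :=
  (AlgHom.equalizer ψ (TrivSqZeroExt.inlAlgHom K L L)).toIntermediateField (by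
    intro x hx
    by_cases h : x = 0
    · simp [h, zero_mem]
    have hx' : ψ x = TrivSqZeroExt.inlAlgHom K L L x := hx
    change ψ x⁻¹ = TrivSqZeroExt.inlAlgHom K L L x⁻¹
    have hu : IsUnit (ψ x) := (Ne.isUnit h).map ψ
    apply hu.mul_left_cancel
    rw [← map_mul, hx', ← map_mul, mul_inv_cancel₀ h, map_one, map_one])

theorem mem_constants {L : Type*} [Field L] [Algebra K L] {ψ : L →ₐ[K] TrivSqZeroExt L L}
    {x : L} : x ∈ constants ψ ↔ ψ x = TrivSqZeroExt.inl x := Iff.rfl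

/-- A homomorphism to the dual numbers that is constant on a subfield is constant on the elements
that are separable over this subfield. -/
theorem snd_eq_zero_of_isSeparable {L : Type*} [Field L] [Algebra K L]
    (ψ : L →ₐ[K] TrivSqZeroExt L L) (E : IntermediateField K L)
    (hE : ∀ e ∈ E, ψ e = TrivSqZeroExt.inl e) {f : L} (hf : IsSeparable E f)
    (hfst : (ψ f).fst = f) : (ψ f).snd = 0 := by
  set P := (minpoly E f).map (algebraMap E L) with hP
  have hsep : P.Separable := Polynomial.Separable.map hf
  have hroot : P.eval f = 0 := by
    rw [hP, Polynomial.eval_map_algebraMap]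
    exact minpoly.aeval E f
  have hder : P.derivative.eval f ≠ 0 := hsep.eval₂_derivative_ne_zero (RingHom.id L) hroot
  have hcomp : (ψ : L →+* TrivSqZeroExt L L).comp (algebraMap E L) =
      (TrivSqZeroExt.inlHom L L).comp (algebraMap E L) := by
    ext1 e
    exact hE e e.2
  have h0 : (minpoly E f).eval₂ ((ψ : L →+* TrivSqZeroExt L L).comp (algebraMap E L)) (ψ f) = 0 := by
    have h := congrArg ψ (minpoly.aeval E f)
    rw [map_zero, Polynomial.aeval_def] at h
    rw [← h]
    exact (Polynomial.hom_eval₂ _ _ (ψ : L →+* TrivSqZeroExt L L) _).symm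
  rw [hcomp, ← Polynomial.eval₂_map, ← hP] at h0
  -- Taylor's formula `Q(f + ε d) = Q(f) + ε Q'(f) d`. For the minimal polynomial it leaves `Q'(f) d
  -- = 0`, and `Q'(f) ≠ 0` by separability.
  have key : ∀ Q : Polynomial L, Q.eval₂ (TrivSqZeroExt.inlHom L L) (ψ f) =
      TrivSqZeroExt.inl (Q.eval f) +
        TrivSqZeroExt.inr (Q.derivative.eval f * (ψ f).snd) := by
    intro Q
    have hψ : ψ f = TrivSqZeroExt.inl f + TrivSqZeroExt.inr (ψ f).snd := by
      conv_lhs => rw [← TrivSqZeroExt.inl_fst_add_inr_snd_eq (ψ f), hfst]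
    induction Q using Polynomial.induction_on' with
    | add Q R hQ hR =>
      simp only [Polynomial.eval₂_add, hQ, hR, Polynomial.eval_add, Polynomial.derivative_add,
        add_mul, TrivSqZeroExt.inl_add, TrivSqZeroExt.inr_add]
      ring
    | monomial n a =>
      have hpow : ψ f ^ n = TrivSqZeroExt.inl (f ^ n) +
          TrivSqZeroExt.inr (n * f ^ (n - 1) * (ψ f).snd) := by
        ext
        · simp [hfst]
        · simp [TrivSqZeroExt.snd_pow, hfst, mul_assoc]
      rw [Polynomial.eval₂_monomial, hpow, Polynomial.eval_monomial, Polynomial.derivative_monomial,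
        Polynomial.eval_monomial, TrivSqZeroExt.inlHom_apply]
      ext
      · simp
      · simp; ring
  rw [key, hroot] at h0
  have h1 := congrArg TrivSqZeroExt.snd h0
  simp only [TrivSqZeroExt.snd_add, TrivSqZeroExt.snd_inl, TrivSqZeroExt.snd_inr, zero_add,
    TrivSqZeroExt.snd_zero] at h1
  exact (mul_eq_zero.1 h1).resolve_left hder

/-- The derivative of `x / y` is `y⁻¹ ≠ 0`. -/
theorem not_isSeparable_div {L : Type*} [Field L] [Algebra K L]
    (ψ : L →ₐ[K] TrivSqZeroExt L L) (E : IntermediateField K L) (hE : E ≤ constants ψ) {x y : L}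
    (hy0 : y ≠ 0) (hy : y ∈ constants ψ)
    (hx : ψ x = TrivSqZeroExt.inl x + TrivSqZeroExt.inr 1) : ¬ IsSeparable E (x / y) := by
  intro hsep
  have hval : ψ (x / y) = TrivSqZeroExt.inl (x / y) + TrivSqZeroExt.inr y⁻¹ := by
    rw [div_eq_mul_inv, map_mul, mem_constants.1 (inv_mem hy), hx]
    ext
    · simp
    · simp
  have hsnd := snd_eq_zero_of_isSeparable ψ E (fun e he => mem_constants.1 (hE he)) hsep
    (by rw [hval]; simp)
  rw [hval] at hsnd
  simp [hy0] at hsnd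

variable [IsAlgClosed K] [Fact p.Prime] [CharP K p]

theorem IsSeparableGaussMap.pos_of_gaussMap_eq_zero (hz : C.IsSeparableGaussMap p r z)
    (h0 : C.gaussMap 0 = 0) : 0 < r := by
  rw [Nat.pos_iff_ne_zero]
  rintro rfl
  have hd := hz.two_le_degree
  obtain ⟨μ, hμ, hg⟩ := hz.exists_gaussMap_eq
  simp only [pow_zero, pow_one] at hg
  have hx := coord_ne_zero hd
  have hprime : (Ideal.span {C.poly}).IsPrime :=
    (Ideal.span_singleton_prime C.irreducible.ne_zero).2 C.irreducible.prime
  obtain ⟨ψ, hψ⟩ := exists_algHom_dualNumber (I := Ideal.span {C.poly}) C.proj (fun P => rfl)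
      fun P hP => by
    obtain ⟨Q, rfl⟩ := Ideal.mem_span_singleton.1 hP
    rw [pderiv_mul, map_add, map_mul, map_mul, proj_poly, zero_mul, add_zero,
      show C.proj (pderiv 0 C.poly) = 0 from h0, zero_mul]
  set E := constants ψ
  have hmem : ∀ i, i ≠ 0 → C.coord i ∈ E := by
    intro i hi
    rw [mem_constants, coord, hψ, if_neg hi, TrivSqZeroExt.inr_zero, add_zero]
  have he := sum_coord_mul_gaussMap (C := C)
  rw [Fin.sum_univ_three, h0, mul_zero, zero_add, hg 1, hg 2] at he
  have he' : C.coord 1 * z 1 + C.coord 2 * z 2 = 0 := by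
    apply (mul_eq_zero.1 (_ : μ * _ = 0)).resolve_left hμ
    linear_combination he
  have hz0 : z 0 = 0 := by
    rw [hg, mul_eq_zero] at h0
    exact h0.resolve_left hμ
  -- `z` is proportional to `(0 : - x₂ : x₁)`
  have hzE : ∀ i, ∃ e ∈ E, z i = e * z 2 := by
    intro i
    fin_cases i
    · exact ⟨0, zero_mem _, by simp [hz0]⟩
    · refine ⟨-C.coord 2 / C.coord 1, div_mem (neg_mem (hmem 2 (by decide))) (hmem 1 (by decide)), ?_⟩
      change z 1 = _
      field_simp [hx 1]
      linear_combination he'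
    · exact ⟨1, one_mem _, (one_mul _).symm⟩
  have hle : C.imageField z ≤ E := by
    rw [imageField, IntermediateField.adjoin_le_iff]
    rintro _ ⟨i, j, rfl⟩
    rw [SetLike.mem_coe]
    obtain ⟨e, heE, hi⟩ := hzE i
    obtain ⟨e', heE', hj⟩ := hzE j
    by_cases h2 : z 2 = 0
    · rw [hi, h2, mul_zero, zero_div]
      exact zero_mem _
    · rw [hi, hj, mul_div_mul_right _ _ h2]
      exact div_mem heE heE'
  refine not_isSeparable_div ψ (C.imageField z) hle (hx 1) (hmem 1 (by decide)) ?_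
    (hz.2.2.2 _ (C.coordQuot 0 1).2)
  rw [coord, hψ, if_pos rfl]

end PlaneCurve

/-! ### Finite groups of affine substitutions. -/

/-- A finite group acting freely on the nontrivial elements of a normal subgroup by conjugation has
order dividing the number of these elements. -/
theorem Subgroup.card_dvd_card_sub_one_of_conj {G : Type*} [Group G] [Finite G] (E H : Subgroup G)
    [E.Normal] (h : ∀ g ∈ E, ∀ k ∈ H, k * g = g * k → g ≠ 1 → k = 1) :
    Nat.card H ∣ Nat.card E - 1 := by
  let X := {g : E // g ≠ 1}
  let act : MulAction H X :=
    { smul := fun k g => ⟨⟨k * g.1 * (k : G)⁻¹, Subgroup.Normal.conj_mem inferInstance _ g.1.2 _⟩,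
        fun hk => g.2 (by
          have hk' : (k : G) * g.1 * (k : G)⁻¹ = 1 := congrArg Subtype.val hk
          rw [mul_inv_eq_one, mul_eq_left] at hk'
          exact Subtype.ext hk')⟩
      one_smul := fun g => Subtype.ext (Subtype.ext (by
        change ((1 : H) : G) * g.1 * ((1 : H) : G)⁻¹ = g.1
        simp))
      mul_smul := fun k l g => Subtype.ext (Subtype.ext (by
        change ((k * l : H) : G) * g.1 * ((k * l : H) : G)⁻¹ =
          (k : G) * ((l : G) * g.1 * (l : G)⁻¹) * (k : G)⁻¹
        simp [mul_assoc])) }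
  have hfree : ∀ g : X, MulAction.stabilizer H g = ⊥ := by
    intro g
    rw [eq_bot_iff]
    intro k hk
    have hk' : (k : G) * g.1 * (k : G)⁻¹ = g.1 :=
      congrArg (fun y : X => ((y.1 : E) : G)) (MulAction.mem_stabilizer_iff.1 hk)
    rw [mul_inv_eq_iff_eq_mul] at hk'
    exact Subtype.ext (h _ g.1.2 k k.2 hk' fun h1 => g.2 (Subtype.ext h1))
  have hcard := Nat.card_congr (MulAction.selfEquivOrbitsQuotientProd hfree)
  rw [Nat.card_prod] at hcard
  have hX : Nat.card X = Nat.card E - 1 := by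
    classical
    have := Fintype.ofFinite E
    rw [Nat.card_eq_fintype_card, Nat.card_eq_fintype_card, Fintype.card_subtype_compl,
      Fintype.card_subtype_eq]
  rw [← hX, hcard]
  exact dvd_mul_left _ _

/-- The structure of a finite group of automorphisms of the form
`u ↦ a u + b v + c`, `v ↦ v` of a function field generated by `u` and `v`. -/
theorem exists_semidirect_of_affine {K L : Type*} [Field K] [Field L] [Algebra K L] (p : ℕ)
    [Fact p.Prime] [CharP K p] (G : Subgroup (L ≃ₐ[K] L)) [Finite G] (u v : L)
    (hind : ∀ a b c : K, algebraMap K L a * u + algebraMap K L b * v + algebraMap K L c = 0 →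
      a = 0 ∧ b = 0 ∧ c = 0)
    (hext : ∀ σ τ : L ≃ₐ[K] L, σ u = τ u → σ v = τ v → σ = τ)
    (haff : ∀ σ ∈ G, σ v = v ∧ ∃ a b c : K, a ≠ 0 ∧
      σ u = algebraMap K L a * u + algebraMap K L b * v + algebraMap K L c) :
    ∃ E H : Subgroup G, E.Normal ∧ E.IsComplement' H ∧
      (∀ g ∈ E, ∀ h ∈ E, g * h = h * g) ∧ (∀ g ∈ E, g ^ p = 1) ∧
      IsCyclic H ∧ Nat.card H ∣ Nat.card E - 1 ∧ ¬ p ∣ Nat.card H ∧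
      ∀ σ ∈ G, ∀ a b c : K,
        σ u = algebraMap K L a * u + algebraMap K L b * v + algebraMap K L c →
        a ^ (Nat.card E - 1) = 1 ∧ (σ ≠ 1 → (a = 1 ↔ orderOf σ = p)) := by
  have hp : p.Prime := Fact.out
  have hv : ∀ σ : G, (σ : L ≃ₐ[K] L) v = v := fun σ => (haff σ σ.2).1
  choose a b c ha hu using fun σ : G => (haff σ σ.2).2
  have huniq : ∀ a b c a' b' c' : K,
      algebraMap K L a * u + algebraMap K L b * v + algebraMap K L c =
      algebraMap K L a' * u + algebraMap K L b' * v + algebraMap K L c' →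
      a = a' ∧ b = b' ∧ c = c' := by
    intro a b c a' b' c' h
    have := hind (a - a') (b - b') (c - c') (by simp only [map_sub]; linear_combination h)
    simpa only [sub_eq_zero] using this
  have hone : (1 : L ≃ₐ[K] L) u =
      algebraMap K L 1 * u + algebraMap K L 0 * v + algebraMap K L 0 := by simp
  have hmul : ∀ σ τ : G, ((σ * τ : G) : L ≃ₐ[K] L) u = algebraMap K L (a τ * a σ) * u +
      algebraMap K L (a τ * b σ + b τ) * v + algebraMap K L (a τ * c σ + c τ) := by
    intro σ τ
    change (σ : L ≃ₐ[K] L) ((τ : L ≃ₐ[K] L) u) = _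
    rw [hu τ, map_add, map_add, map_mul, map_mul, hu σ, hv]
    simp only [AlgEquiv.commutes, map_add, map_mul]
    ring
  let χ : G →* K :=
    { toFun := a
      map_one' := (huniq _ _ _ _ _ _ ((hu 1).symm.trans hone)).1
      map_mul' := fun σ τ => by
        rw [mul_comm (a σ)]
        exact (huniq _ _ _ _ _ _ ((hu (σ * τ)).symm.trans (hmul σ τ))).1 }
  let α : G →* Kˣ := χ.toHomUnits
  have hα : ∀ σ, ((α σ : Kˣ) : K) = a σ := fun σ => rfl
  have hker : ∀ σ, σ ∈ α.ker ↔ a σ = 1 := by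
    intro σ
    rw [MonoidHom.mem_ker, Units.ext_iff, hα, Units.val_one]
  have hpow : ∀ σ ∈ α.ker, ∀ n : ℕ, ((σ ^ n : G) : L ≃ₐ[K] L) u =
      u + n * (algebraMap K L (b σ) * v + algebraMap K L (c σ)) := by
    intro σ hσ n
    have h1 := hu σ
    rw [(hker σ).1 hσ] at h1
    induction n with
    | zero => simp
    | succ n ih =>
      rw [pow_succ']
      change (σ : L ≃ₐ[K] L) (((σ ^ n : G) : L ≃ₐ[K] L) u) = _
      rw [ih, map_add, h1, map_mul, map_add, map_mul, hv, map_natCast]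
      simp only [AlgEquiv.commutes, map_one, Nat.cast_add, Nat.cast_one]
      ring
  have hcharL : CharP L p := charP_of_injective_algebraMap' K p
  have hexp : ∀ σ ∈ α.ker, σ ^ p = 1 := by
    intro σ hσ
    apply Subtype.ext
    apply hext
    · rw [hpow σ hσ, CharP.cast_eq_zero, zero_mul, add_zero]
      rfl
    · rw [hv]
      rfl
  have hpg : IsPGroup p α.ker := fun g => ⟨1, by
    rw [pow_one]
    exact Subtype.ext (hexp g g.2)⟩
  -- In characteristic `p`, `x ^ p - 1 = (x - 1) ^ p`.
  have hroot : ∀ x : K, x ^ p = 1 → x = 1 := fun x hx => by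
    have : (x - 1) ^ p = 0 := by rw [sub_pow_char, hx, one_pow, sub_self]
    exact sub_eq_zero.1 (eq_zero_of_pow_eq_zero this)
  have hindex : ¬ p ∣ α.ker.index := by
    rw [Subgroup.index_ker]
    have : Finite α.range := Finite.of_surjective _ α.rangeRestrict_surjective
    intro hdvd
    obtain ⟨x, hx⟩ := exists_prime_orderOf_dvd_card' p hdvd
    have h1 : x ^ p = 1 := hx ▸ pow_orderOf_eq_one x
    have h2 : x = 1 := by
      apply Subtype.ext
      apply Units.ext
      apply hroot
      have := congrArg (fun y : α.range => ((y : Kˣ) : K)) h1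
      simpa using this
    rw [h2, orderOf_one] at hx
    exact hp.one_lt.ne hx
  obtain ⟨n, hn⟩ := IsPGroup.iff_card.1 hpg
  -- Schur–Zassenhaus.
  obtain ⟨H, hH⟩ := Subgroup.exists_right_complement'_of_coprime (N := α.ker) (by
    rw [hn]
    exact Nat.Coprime.pow_left _ ((Nat.Prime.coprime_iff_not_dvd hp).2 hindex))
  have hcardH : Nat.card H = α.ker.index := hH.symm.index_eq_card.symm
  have hdisj : ∀ h ∈ H, a h = 1 → h = 1 := fun h hh h1 =>
    Subgroup.disjoint_def.1 hH.disjoint ((hker h).2 h1) hh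
  -- If `k` commutes with the translation `g`, then `(a k - 1) * b g = 0` and `(a k - 1) * c g = 0`;
  -- on `H`, only `1` has `a = 1`.
  have hdvd : Nat.card H ∣ Nat.card α.ker - 1 := by
    apply Subgroup.card_dvd_card_sub_one_of_conj
    intro g hg k hk hcomm hg1
    by_contra hk1
    have hak : a k - 1 ≠ 0 := fun h => hk1 (hdisj k hk (sub_eq_zero.1 h))
    have h1 := (hmul k g).symm.trans ((congrArg (fun x : G => (x : L ≃ₐ[K] L) u) hcomm).trans
      (hmul g k))
    rw [(hker g).1 hg] at h1
    obtain ⟨-, hb, hc⟩ := huniq _ _ _ _ _ _ h1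
    have hb0 : b g = 0 := by
      refine (mul_eq_zero.1 (?_ : (a k - 1) * b g = 0)).resolve_left hak
      linear_combination -hb
    have hc0 : c g = 0 := by
      refine (mul_eq_zero.1 (?_ : (a k - 1) * c g = 0)).resolve_left hak
      linear_combination -hc
    apply hg1
    apply Subtype.ext
    apply hext
    · rw [hu g, (hker g).1 hg, hb0, hc0]
      exact hone.symm
    · rw [hv]
      rfl
  refine ⟨α.ker, H, inferInstance, hH, ?_, hexp, ?_, hdvd, hcardH ▸ hindex, ?_⟩
  · intro g hg h hh
    apply Subtype.ext
    apply hext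
    · rw [hmul, hmul, (hker g).1 hg, (hker h).1 hh]
      simp only [map_add, map_mul, map_one]
      ring
    · rw [hv, hv]
  · refine isCyclic_of_injective_ringHom (χ.comp H.subtype) ?_
    intro x y hxy
    have h1 : a (x * y⁻¹ : H) = 1 := by
      have h2 : χ x = χ y := hxy
      have h3 : χ ((x : G) * (y : G)⁻¹) = 1 := by
        rw [map_mul, h2, ← map_mul, mul_inv_cancel, map_one]
      exact h3
    have h4 := hdisj _ (x * y⁻¹).2 h1
    exact mul_inv_eq_one.1 (Subtype.ext h4)
  · intro σ hσ a' b' c' h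
    obtain ⟨rfl, -, -⟩ := huniq _ _ _ _ _ _ ((hu ⟨σ, hσ⟩).symm.trans h)
    constructor
    -- The order of `a` divides `|α.range| = |H|`, which divides `|E| - 1`; for trivial `E` the
    -- exponent is `0`.
    · have h1 : (α.rangeRestrict ⟨σ, hσ⟩) ^ Nat.card α.range = 1 := pow_card_eq_one'
      rw [← Subgroup.index_ker, ← hcardH] at h1
      have h2 := congrArg (fun y : α.range => ((y : Kˣ) : K)) h1
      have h3 : a ⟨σ, hσ⟩ ^ Nat.card H = 1 := by simpa [hα] using h2
      obtain ⟨m, hm⟩ := hdvd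
      rw [hm, pow_mul, h3, one_pow]
    · intro hne
      constructor
      · intro h1
        have h2 := congrArg Subtype.val (hexp ⟨σ, hσ⟩ ((hker _).2 h1))
        exact orderOf_eq_prime h2 hne
      · intro h1
        apply hroot
        have h2 : (⟨σ, hσ⟩ : G) ^ p = 1 := Subtype.ext (h1 ▸ pow_orderOf_eq_one σ)
        have h3 : χ (⟨σ, hσ⟩ ^ p) = 1 := by rw [h2, map_one]
        rwa [map_pow] at h3

/-! ### Affine coordinates of the transformed curve and finiteness of the group. -/

namespace PlaneCurve

open MvPolynomial Matrix

variable {K : Type*} [Field K] {C : PlaneCurve K}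

/-- The coordinate functions `x'_i / x'_2`, where `x' = T⁻¹ x`. -/
noncomputable def affCoord (C : PlaneCurve K) (T : GL (Fin 3) K) (i : Fin 3) : C.functionField :=
  ⟨C.proj (linForm ((T⁻¹ : GL (Fin 3) K) : Matrix (Fin 3) (Fin 3) K) i) / C.coord 2 ^ 1,
      proj_div_pow_mem (linForm_isHomogeneous _ i) 2⟩ /
    ⟨C.proj (linForm ((T⁻¹ : GL (Fin 3) K) : Matrix (Fin 3) (Fin 3) K) 2) / C.coord 2 ^ 1,
      proj_div_pow_mem (linForm_isHomogeneous _ 2) 2⟩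

theorem coe_affCoord (hd : 2 ≤ C.degree) (T : GL (Fin 3) K) (i : Fin 3) :
    (C.affCoord T i : C.ConeField) =
      C.proj (linForm ((T⁻¹ : GL (Fin 3) K) : Matrix (Fin 3) (Fin 3) K) i) /
        C.proj (linForm ((T⁻¹ : GL (Fin 3) K) : Matrix (Fin 3) (Fin 3) K) 2) :=
  div_div_div_cancel_right₀ (pow_ne_zero _ (coord_ne_zero hd 2)) _ _

theorem affCoord_two (hd : 2 ≤ C.degree) (T : GL (Fin 3) K) : C.affCoord T 2 = 1 :=
  Subtype.ext ((coe_affCoord hd T 2).trans (div_self (proj_linForm_ne_zero hd T⁻¹ 2)))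

theorem eq_zero_of_sum_affCoord (hd : 2 ≤ C.degree) (T : GL (Fin 3) K) {v : Fin 3 → K}
    (h : ∑ i, algebraMap K C.functionField (v i) * C.affCoord T i = 0) : v = 0 := by
  have hne := proj_linForm_ne_zero hd T⁻¹ 2
  have h1 : ∑ i, algebraMap K C.ConeField (v i) *
      C.proj (linForm ((T⁻¹ : GL (Fin 3) K) : Matrix (Fin 3) (Fin 3) K) i) = 0 := by
    have h2 := congrArg (algebraMap C.functionField C.ConeField) h
    rw [map_zero, map_sum] at h2
    have h3 : ∀ i, algebraMap C.functionField C.ConeField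
        (algebraMap K C.functionField (v i) * C.affCoord T i) = algebraMap K C.ConeField (v i) *
      C.proj (linForm ((T⁻¹ : GL (Fin 3) K) : Matrix (Fin 3) (Fin 3) K) i) /
        C.proj (linForm ((T⁻¹ : GL (Fin 3) K) : Matrix (Fin 3) (Fin 3) K) 2) := by
      intro i
      rw [map_mul, mul_div_assoc, ← coe_affCoord hd]
      rfl
    simp only [h3] at h2
    rw [← Finset.sum_div, div_eq_zero_iff] at h2
    exact h2.resolve_right hne
  have h4 : v ᵥ* ((T⁻¹ : GL (Fin 3) K) : Matrix (Fin 3) (Fin 3) K) = 0 := by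
    apply linearIndependent_coord hd
    rw [← h1]
    simp only [proj_linForm, Matrix.vecMul, dotProduct, map_sum, map_mul, Finset.sum_mul,
      Finset.mul_sum, mul_assoc]
    exact Finset.sum_comm
  apply eq_zero_of_vecMul_map_eq_zero (A := K) T⁻¹
  have h5 : ((T⁻¹ : GL (Fin 3) K) : Matrix (Fin 3) (Fin 3) K).map (algebraMap K K) =
      ((T⁻¹ : GL (Fin 3) K) : Matrix (Fin 3) (Fin 3) K) := by ext; rfl
  rw [h5, h4]

theorem coordQuot_eq_affCoord (hd : 2 ≤ C.degree) (T : GL (Fin 3) K) (i j : Fin 3) :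
    C.coordQuot i j =
      (∑ k, algebraMap K C.functionField ((T : Matrix (Fin 3) (Fin 3) K) i k) * C.affCoord T k) /
      ∑ k, algebraMap K C.functionField ((T : Matrix (Fin 3) (Fin 3) K) j k) * C.affCoord T k := by
  set N := ((T⁻¹ : GL (Fin 3) K) : Matrix (Fin 3) (Fin 3) K) with hN
  have hne := proj_linForm_ne_zero hd T⁻¹ 2
  have h : ∀ i, algebraMap C.functionField C.ConeField (∑ k, algebraMap K C.functionField
      ((T : Matrix (Fin 3) (Fin 3) K) i k) * C.affCoord T k) =
      C.coord i / C.proj (linForm N 2) := by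
    intro i
    rw [map_sum]
    have h1 : C.coord i = ∑ k, algebraMap K C.ConeField ((T : Matrix (Fin 3) (Fin 3) K) i k) *
        C.proj (linForm N k) := by
      have h2 := congrArg C.proj (aeval_linForm_linForm N (T : Matrix (Fin 3) (Fin 3) K) i)
      rw [hN, ← Units.val_mul, mul_inv_cancel, Units.val_one, linForm_one, ← hN, proj_aeval,
        aeval_linForm] at h2
      exact h2.symm
    rw [h1, Finset.sum_div]
    refine Finset.sum_congr rfl fun k _ => ?_
    rw [map_mul, mul_div_assoc, hN, ← coe_affCoord hd]
    rfl
  apply FaithfulSMul.algebraMap_injective C.functionField C.ConeField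
  rw [map_div₀, h, h, div_div_div_cancel_right₀ hne]
  rfl

theorem aut_ext_affCoord (hd : 2 ≤ C.degree) (T : GL (Fin 3) K) (σ τ : C.Aut)
    (h0 : σ (C.affCoord T 0) = τ (C.affCoord T 0)) (h1 : σ (C.affCoord T 1) = τ (C.affCoord T 1)) :
    σ = τ := by
  have h : ∀ k, σ (C.affCoord T k) = τ (C.affCoord T k) := by
    intro k
    fin_cases k
    · exact h0
    · exact h1
    · change σ (C.affCoord T 2) = τ (C.affCoord T 2)
      rw [affCoord_two hd, map_one, map_one]
  refine aut_ext fun i j => ?_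
  rw [coordQuot_eq_affCoord hd T]
  simp only [map_div₀, map_sum, map_mul, AlgEquiv.commutes, h]

theorem IsInducedBy.apply_affCoord {σ : C.Aut} {T : GL (Fin 3) K} {a b c : K}
    (hσ : C.IsInducedBy σ
      ((T : Matrix (Fin 3) (Fin 3) K) * !![a, b, c; 0, 1, 0; 0, 0, 1] *
        ((T⁻¹ : GL (Fin 3) K) : Matrix (Fin 3) (Fin 3) K))) (hd : 2 ≤ C.degree) :
    σ (C.affCoord T 1) = C.affCoord T 1 ∧
      σ (C.affCoord T 0) = algebraMap K _ a * C.affCoord T 0 +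
        algebraMap K _ b * C.affCoord T 1 + algebraMap K _ c := by
  set N := ((T⁻¹ : GL (Fin 3) K) : Matrix (Fin 3) (Fin 3) K) with hN
  set A : Matrix (Fin 3) (Fin 3) K := !![a, b, c; 0, 1, 0; 0, 0, 1] with hA
  have hne := proj_linForm_ne_zero hd T⁻¹ 2
  have hx := coord_ne_zero hd 2
  let y : Fin 3 → C.functionField := fun i =>
    ⟨C.proj (linForm N i) / C.coord 2 ^ 1, proj_div_pow_mem (linForm_isHomogeneous _ i) 2⟩
  have hy : ∀ i, C.affCoord T i = y i / y 2 := fun _ => rfl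
  set l := C.proj (linForm ((T : Matrix (Fin 3) (Fin 3) K) * A * N) 2)
  -- Since `N = T⁻¹`, the product `N * (T * A * N)` collapses to `A * N`.
  have hσy : ∀ i, (σ (y i) : C.ConeField) =
      (∑ k, algebraMap K _ (A i k) * C.proj (linForm N k)) / l ^ 1 := by
    intro i
    rw [hσ.coe_apply_eq (linForm_isHomogeneous N i) (y i) rfl, aeval_linForm_linForm,
      ← mul_assoc, ← mul_assoc, hN, ← Units.val_mul, inv_mul_cancel, Units.val_one, one_mul, ← hN,
      ← aeval_linForm_linForm, proj_aeval, aeval_linForm]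
  have hσ2 : (σ (y 2) : C.ConeField) = C.proj (linForm N 2) / l ^ 1 := by
    rw [hσy, Fin.sum_univ_three]
    simp [hA]
  -- With `l = 0`, division by zero would give `σ (y 2) = 0`, against injectivity of `σ`.
  have hl : l ^ 1 ≠ 0 := by
    intro hl
    rw [hl, div_zero] at hσ2
    have h0 : y 2 = 0 := (map_eq_zero σ).1 (Subtype.ext hσ2)
    have h1 : C.proj (linForm N 2) / C.coord 2 ^ 1 = 0 := congrArg Subtype.val h0
    exact div_ne_zero hne (pow_ne_zero _ hx) h1
  have hval : ∀ i, (σ (C.affCoord T i) : C.ConeField) =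
      (∑ k, algebraMap K _ (A i k) * C.proj (linForm N k)) / C.proj (linForm N 2) := by
    intro i
    rw [hy, map_div₀]
    change (σ (y i) : C.ConeField) / σ (y 2) = _
    rw [hσy, hσ2, div_div_div_cancel_right₀ hl]
  constructor
  · apply Subtype.ext
    rw [hval, coe_affCoord hd, Fin.sum_univ_three]
    simp [hA, hN]
  · apply Subtype.ext
    rw [hval, Fin.sum_univ_three]
    change _ = algebraMap K C.ConeField a * (C.affCoord T 0 : C.ConeField) +
      algebraMap K C.ConeField b * (C.affCoord T 1 : C.ConeField) + algebraMap K C.ConeField c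
    rw [coe_affCoord hd, coe_affCoord hd, ← hN]
    simp only [hA, Matrix.of_apply, Matrix.cons_val_zero, Matrix.cons_val_one, Matrix.cons_val]
    have hne' : C.proj (linForm N 2) ≠ 0 := hne
    rw [add_div, add_div, mul_div_assoc, mul_div_assoc, mul_div_cancel_right₀ _ hne']

variable {p r : ℕ} {z : Fin 3 → C.ConeField}

/-- An element that is integral over a fixed subfield has a finite orbit. -/
theorem finite_range_apply_of_isIntegral {A : Type*} [Field A] [Algebra K A]
    {E F : IntermediateField K A} (hEF : E ≤ F) (G : Subgroup (F ≃ₐ[K] F))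
    (hfix : ∀ σ ∈ G, ∀ f : F, (f : A) ∈ E → σ f = f) (f : F) (hf : IsIntegral E (f : A)) :
    (Set.range fun σ : G => (σ : F ≃ₐ[K] F) f).Finite := by
  classical
  let ι : E →+* F := (IntermediateField.inclusion hEF : E →+* F)
  have hι : (algebraMap F A).comp ι = algebraMap E A := rfl
  set P := (minpoly E (f : A)).map ι with hP
  have hP0 : P ≠ 0 := Polynomial.map_ne_zero (minpoly.ne_zero hf)
  have hroot : P.eval f = 0 := by
    apply FaithfulSMul.algebraMap_injective F A
    rw [map_zero, Polynomial.eval_map, Polynomial.hom_eval₂, hι]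
    exact minpoly.aeval E (f : A)
  refine (P.roots.toFinset.finite_toSet).subset ?_
  rintro _ ⟨σ, rfl⟩
  rw [Finset.mem_coe, Multiset.mem_toFinset, Polynomial.mem_roots hP0, Polynomial.IsRoot]
  -- The coefficients of `P` are fixed by `σ`, so `σ f` is again one of its finitely many roots.
  have hσι : ((σ : F ≃ₐ[K] F) : F →+* F).comp ι = ι := by
    ext1 e
    exact hfix σ σ.2 (ι e) e.2
  have h1 := congrArg ((σ : F ≃ₐ[K] F) : F →+* F) hroot
  rw [map_zero, Polynomial.eval_map, Polynomial.hom_eval₂, hσι, ← Polynomial.eval_map] at h1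
  exact h1

/-- A group of automorphisms that fixes the separable Gauss map is finite. -/
theorem IsSeparableGaussMap.finite (hz : C.IsSeparableGaussMap p r z) (hd : 2 ≤ C.degree)
    (G : Subgroup C.Aut) (hsub : C.imageField z ≤ C.quotientField G) : Finite G := by
  have hroots : ∀ f : C.functionField, (Set.range fun σ : G => (σ : C.Aut) f).Finite := fun f =>
    finite_range_apply_of_isIntegral hz.2.1 G
      (fun σ hσ f hf => coe_apply_eq_of_mem hsub hσ f hf) f (hz.2.2.2 f f.2).isIntegral
  have h0 := (hroots (C.affCoord 1 0)).to_subtype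
  have h1 := (hroots (C.affCoord 1 1)).to_subtype
  let f : G → (Set.range fun σ : G => (σ : C.Aut) (C.affCoord 1 0)) ×
      (Set.range fun σ : G => (σ : C.Aut) (C.affCoord 1 1)) :=
    fun σ => (⟨_, ⟨σ, rfl⟩⟩, ⟨_, ⟨σ, rfl⟩⟩)
  -- An automorphism is determined by its values on two affine coordinates, each with a finite
  -- orbit.
  refine Finite.of_injective f fun σ τ h => ?_
  exact Subtype.ext (aut_ext_affCoord hd 1 _ _ (congrArg (fun x => x.1.1) h)
    (congrArg (fun x => x.2.1) h))

end PlaneCurve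

/-! ### Assembly of the theorem. -/

theorem mainTheorem6 (p : ℕ) [Fact p.Prime] (hp : 2 < p)
    (k : Type*) [Field k] [Finite k] [CharP k p]
    (K : Type*) [Field K] [Algebra k K] [IsAlgClosure k K]
    (C : PlaneCurve K) (hC : C.IsDefinedOver k)
    (r : ℕ) (z : Fin 3 → C.ConeField) (hz : C.IsSeparableGaussMap p r z)
    (G : Subgroup C.Aut) (hlin : C.IsLinear G) (hG : G ≠ ⊥)
    (hsub : C.imageField z ≤ C.quotientField G) :
    ∃ (T : GL (Fin 3) K) (C' : PlaneCurve K),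
      C'.IsTransformOf C T ∧
      (0 < r ∧
        ∃ (m : ℕ) (Z₁ Z₂ : MvPolynomial (Fin 3) K),
          Z₁.IsHomogeneous m ∧ Z₂.IsHomogeneous m ∧
          C'.IsSeparableGaussMap p r ![0, C'.proj Z₁, C'.proj Z₂] ∧
          C'.poly ∣ Z₁ ^ p ^ r * MvPolynomial.X 1 + Z₂ ^ p ^ r * MvPolynomial.X 2) ∧
      Finite G ∧
      ∃ E H : Subgroup G,
        E.Normal ∧ E.IsComplement' H ∧
        (∀ g ∈ E, ∀ h ∈ E, g * h = h * g) ∧ (∀ g ∈ E, g ^ p = 1) ∧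
        IsCyclic H ∧ Nat.card H ∣ Nat.card E - 1 ∧ ¬ p ∣ Nat.card H ∧
        ∀ σ ∈ G, ∃ a b c : K,
          C.IsInducedBy σ
            ((T : Matrix (Fin 3) (Fin 3) K) * !![a, b, c; 0, 1, 0; 0, 0, 1] *
              ((T⁻¹ : GL (Fin 3) K) : Matrix (Fin 3) (Fin 3) K)) ∧
          a ≠ 0 ∧ a ^ (Nat.card E - 1) = 1 ∧ (σ ≠ 1 → (a = 1 ↔ orderOf σ = p)) := by
  have : CharP K p := charP_of_injective_algebraMap' k p
  have : IsAlgClosed K := IsAlgClosure.isAlgClosed k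
  have hd := hz.two_le_degree
  have hfix : ∀ σ ∈ G, ∀ f : C.functionField, (f : C.ConeField) ∈ C.imageField z → σ f = f :=
    fun σ hσ f hf => PlaneCurve.coe_apply_eq_of_mem hsub hσ f hf
  obtain ⟨⟨σ₀, hσ₀⟩, hne'⟩ := Subgroup.ne_bot_iff_exists_ne_one.1 hG
  have hne : σ₀ ≠ 1 := fun h => hne' (Subtype.ext h)
  obtain ⟨M₀, hM₀⟩ := hlin σ₀ hσ₀
  obtain ⟨v, hv0, hv⟩ := hM₀.exists_sum_mul_gaussMap_eq_zero hz (hfix _ hσ₀) hne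
  obtain ⟨T, hT⟩ := PlaneCurve.exists_GL_col_eq v hv0
  have hT0 : C.gaussMapIn T 0 = 0 := by
    rw [← hv]
    simp [PlaneCurve.gaussMapIn, Matrix.vecMul, dotProduct, hT, mul_comm]
  have hg0 : (C.transform T).gaussMap 0 = 0 := by
    rw [PlaneCurve.transform_gaussMap, hT0, map_zero]
  obtain ⟨w, hw⟩ := hz.exists_transform T
  have hfin := hz.finite hd G hsub
  -- Although `T` was chosen from the single element `σ₀`, the condition `hT0` concerns only the
  -- curve, so the same `T` serves all of `G`.
  have hconj : ∀ σ ∈ G, ∃ a b c : K, a ≠ 0 ∧ C.IsInducedBy σ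
      ((T : Matrix (Fin 3) (Fin 3) K) * !![a, b, c; 0, 1, 0; 0, 0, 1] *
        ((T⁻¹ : GL (Fin 3) K) : Matrix (Fin 3) (Fin 3) K)) := by
    intro σ hσ
    obtain ⟨M, hM⟩ := hlin σ hσ
    exact hM.exists_conj hz (hfix σ hσ) T hT0
  obtain ⟨E, H, hE, hEH, hcomm, hexp, hcyc, hdvd, hpH, hall⟩ :=
    exists_semidirect_of_affine p G (C.affCoord T 0) (C.affCoord T 1)
      (fun a b c h => by
        have h1 := PlaneCurve.eq_zero_of_sum_affCoord hd T (v := ![a, b, c]) (by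
          rw [Fin.sum_univ_three, PlaneCurve.affCoord_two hd, mul_one]
          exact h)
        exact ⟨congrFun h1 0, congrFun h1 1, congrFun h1 2⟩)
      (PlaneCurve.aut_ext_affCoord hd T)
      (fun σ hσ => by
        obtain ⟨a, b, c, ha, h⟩ := hconj σ hσ
        obtain ⟨h1, h2⟩ := h.apply_affCoord hd
        exact ⟨h1, a, b, c, ha, h2⟩)
  refine ⟨T, C.transform T, C.transform_isTransformOf T,
    ⟨hw.pos_of_gaussMap_eq_zero hg0, hw.exists_forms hg0⟩, hfin, E, H, hE, hEH, hcomm, hexp, hcyc,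
    hdvd, hpH, fun σ hσ => ?_⟩
  obtain ⟨a, b, c, ha, h⟩ := hconj σ hσ
  exact ⟨a, b, c, h, ha, hall σ hσ a b c (h.apply_affCoord hd).2⟩
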